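/- Let $\Omega\subset\mathbb{R}^2$ be a domain (open and connected) with $0\in\Omega$, let $k\in\mathbb{R}$, and let $\alpha_1,\alpha_2,\beta_1,\beta_2\in\mathbb{R}$ with $\beta_1\neq 0$ and $\beta_2\neq0$. Let $\theta_1,\theta_2\in\mathbb{R}$ with $\theta_1-\theta_2\notin\pi\mathbb{Q}$, and for $j=1,2$ let $\ell_{\theta_j}=\mathbb{R}(\cos\theta_j,\sin\theta_j)$ be the line through $0$ of direction $\theta_j$, with unit normal $n_j=(-\sin\theta_j,\cos\theta_j)$ and normal derivative $\partial_n u=\nabla u\cdot n_j$. Consider the vector space (over $\mathbb{K}=\mathbb{R}$ or $\mathbb{K}=\mathbb{C}$) of all $C^2$ functions $u:\Omega\to\mathbb{K}$ such that $$ \begin{cases} \Delta u+k^2u=0 & \text{in }\Omega,\\ \alpha_1u+\beta_1\partial_nu=0 & \text{on }\ell_{\theta_1}\cap\Omega,\\ \alpha_2u+\beta_2\partial_nu=0 & \text{on }\ell_{\theta_2}\cap\Omega. \end{cases} $$ Then this space has dimension at most $1$ over $\mathbb{K}$. It has dimension exactly $1$ if $(\theta_1-\theta_2)/\pi$ is badly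 approximable by rationals, in the sense that there is a constant $c>\sqrt5$ such that $$ |q(\theta_1-\theta_2)-p\pi|\ge\frac{1}{cq} $$ for all but finitely many pairs of integers $(q,p)$ with $q\geq1$. -/

import Mathlib

noncomputable section

namespace RobinLines

/-- The Euclidean plane. -/
abbrev Plane : Type := EuclideanSpace ℝ (Fin 2)

/-- The unit vector `(cos θ, sin θ)`. -/
def direction (θ : ℝ) : Plane := !₂[Real.cos θ, Real.sin θ]

/-- The unit normal `(-sin θ, cos θ)` of the line through `0` of direction `(cos θ, sin θ)`. -/
def normal (θ : ℝ) : Plane := !₂[-Real.sin θ, Real.cos θ]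

/-- The line `ℓ_θ = ℝ (cos θ, sin θ)`. -/
def line (θ : ℝ) : Set Plane := {x | ∃ t : ℝ, x = t • direction θ}

variable {𝕜 : Type*} [RCLike 𝕜]

/-- The normal derivative `∂ₙ U` at `x`, for the normal of `ℓ_θ`. -/
def normalDeriv (θ : ℝ) (U : Plane → 𝕜) (x : Plane) : 𝕜 := fderiv ℝ U x (normal θ)

/-- On the set `Ω`, the function `U` is a (classical, `C²`) solution of `Δ U + k² U = 0`. -/
def SolvesHelmholtz (Ω : Set Plane) (k : ℝ) (U : Plane → 𝕜) : Prop :=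
  ContDiffOn ℝ 2 U Ω ∧ ∀ x ∈ Ω, Laplacian.laplacian U x + k ^ 2 • U x = 0

/-- `U` satisfies the Robin condition `α U + β ∂ₙ U = 0` on the part of `ℓ_θ` inside `Ω`. -/
def SatisfiesRobin (Ω : Set Plane) (α β θ : ℝ) (U : Plane → 𝕜) : Prop :=
  ∀ x ∈ line θ ∩ Ω, α • U x + β • normalDeriv θ U x = 0

/-- The extension by `0` to the plane of a function on the open set `Ω`. The derivatives of the
extension at the points of `Ω` are those of the function itself. -/
def zeroExt (Ω : TopologicalSpace.Opens Plane) (u : Ω → 𝕜) : Plane → 𝕜 :=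
  Function.extend (Subtype.val : Ω → Plane) u 0

theorem zeroExt_zero (Ω : TopologicalSpace.Opens Plane) : zeroExt Ω (0 : Ω → 𝕜) = 0 :=
  Function.extend_zero _

theorem zeroExt_add (Ω : TopologicalSpace.Opens Plane) (u v : Ω → 𝕜) :
    zeroExt Ω (u + v) = zeroExt Ω u + zeroExt Ω v := by
  have h := Function.extend_add (Subtype.val : Ω → Plane) u v 0 0
  rwa [add_zero] at h

theorem zeroExt_smul (Ω : TopologicalSpace.Opens Plane) (c : 𝕜) (u : Ω → 𝕜) :
    zeroExt Ω (c • u) = c • zeroExt Ω u := by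
  have h := Function.extend_smul c (Subtype.val : Ω → Plane) u 0
  rwa [smul_zero] at h

/-- `U` solves `ΔU + k²U = 0` on `Ω` with the Robin conditions `α₁ U + β₁ ∂ₙU = 0` on `ℓ_{θ₁}` and
`α₂ U + β₂ ∂ₙU = 0` on `ℓ_{θ₂}`. -/
def IsSolution (Ω : Set Plane) (k α₁ β₁ θ₁ α₂ β₂ θ₂ : ℝ) (U : Plane → 𝕜) : Prop :=
  SolvesHelmholtz Ω k U ∧ SatisfiesRobin Ω α₁ β₁ θ₁ U ∧ SatisfiesRobin Ω α₂ β₂ θ₂ U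

theorem IsSolution.zero (Ω : Set Plane) (k α₁ β₁ θ₁ α₂ β₂ θ₂ : ℝ) :
    IsSolution Ω k α₁ β₁ θ₁ α₂ β₂ θ₂ (0 : Plane → 𝕜) := by
  have hR : ∀ α β θ : ℝ, SatisfiesRobin Ω α β θ (0 : Plane → 𝕜) := by
    intro α β θ x _
    simp [normalDeriv]
  refine ⟨⟨contDiffOn_const, fun x _ => ?_⟩, hR _ _ _, hR _ _ _⟩
  have h := InnerProductSpace.laplacian_smul (0 : ℝ)
    (contDiffAt_const (c := (0 : 𝕜)) : ContDiffAt ℝ 2 (fun _ : Plane => (0 : 𝕜)) x)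
  rw [zero_smul, zero_smul] at h
  rw [h, Pi.zero_apply, smul_zero, add_zero]

theorem IsSolution.add {Ω : Set Plane} (hΩ : IsOpen Ω) {k α₁ β₁ θ₁ α₂ β₂ θ₂ : ℝ}
    {U V : Plane → 𝕜} (hU : IsSolution Ω k α₁ β₁ θ₁ α₂ β₂ θ₂ U)
    (hV : IsSolution Ω k α₁ β₁ θ₁ α₂ β₂ θ₂ V) :
    IsSolution Ω k α₁ β₁ θ₁ α₂ β₂ θ₂ (U + V) := by
  obtain ⟨⟨hu, hu'⟩, hu₁, hu₂⟩ := hU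
  obtain ⟨⟨hv, hv'⟩, hv₁, hv₂⟩ := hV
  have hcu : ∀ x ∈ Ω, ContDiffAt ℝ 2 U x := fun x hx => hu.contDiffAt (hΩ.mem_nhds hx)
  have hcv : ∀ x ∈ Ω, ContDiffAt ℝ 2 V x := fun x hx => hv.contDiffAt (hΩ.mem_nhds hx)
  have hR : ∀ α β θ : ℝ, SatisfiesRobin Ω α β θ U → SatisfiesRobin Ω α β θ V →
      SatisfiesRobin Ω α β θ (U + V) := by
    intro α β θ h h' x hx
    have e := fderiv_add ((hcu x hx.2).differentiableAt two_ne_zero)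
      ((hcv x hx.2).differentiableAt two_ne_zero)
    have h1 := h x hx
    have h2 := h' x hx
    simp only [normalDeriv] at h1 h2 ⊢
    rw [e, add_apply, Pi.add_apply, smul_add, smul_add, add_add_add_comm, h1, h2, add_zero]
  refine ⟨⟨hu.add hv, fun x hx => ?_⟩, hR _ _ _ hu₁ hv₁, hR _ _ _ hu₂ hv₂⟩
  rw [(hcu x hx).laplacian_add (hcv x hx), Pi.add_apply, smul_add, add_add_add_comm,
    hu' x hx, hv' x hx, add_zero]

theorem IsSolution.smul {Ω : Set Plane} (hΩ : IsOpen Ω) {k α₁ β₁ θ₁ α₂ β₂ θ₂ : ℝ} (c : 𝕜)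
    {U : Plane → 𝕜} (hU : IsSolution Ω k α₁ β₁ θ₁ α₂ β₂ θ₂ U) :
    IsSolution Ω k α₁ β₁ θ₁ α₂ β₂ θ₂ (c • U) := by
  obtain ⟨⟨hu, hu'⟩, hu₁, hu₂⟩ := hU
  have hcu : ∀ x ∈ Ω, ContDiffAt ℝ 2 U x := fun x hx => hu.contDiffAt (hΩ.mem_nhds hx)
  have hR : ∀ α β θ : ℝ, SatisfiesRobin Ω α β θ U → SatisfiesRobin Ω α β θ (c • U) := by
    intro α β θ h x hx
    have e := fderiv_const_smul ((hcu x hx.2).differentiableAt two_ne_zero) c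
    have h1 := h x hx
    simp only [normalDeriv] at h1 ⊢
    rw [e, smul_apply, Pi.smul_apply, smul_comm α, smul_comm β, ← smul_add, h1, smul_zero]
  refine ⟨⟨hu.const_smul c, fun x hx => ?_⟩, hR _ _ _ hu₁, hR _ _ _ hu₂⟩
  rw [InnerProductSpace.laplacian_smul c (hcu x hx), Pi.smul_apply, smul_comm (k ^ 2),
    ← smul_add, hu' x hx, smul_zero]

/-- The `𝕜`-vector space of functions `u : Ω → 𝕜`, on the open set `Ω`, that solve
`Δu + k²u = 0` in `Ω` and `α₁ u + β₁ ∂ₙu = 0` on `ℓ_{θ₁}`, `α₂ u + β₂ ∂ₙu = 0` on `ℓ_{θ₂}`. -/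
def solutionSpace (𝕜 : Type*) [RCLike 𝕜] (Ω : TopologicalSpace.Opens Plane)
    (k α₁ β₁ θ₁ α₂ β₂ θ₂ : ℝ) : Submodule 𝕜 (Ω → 𝕜) where
  carrier := {u | IsSolution (Ω : Set Plane) k α₁ β₁ θ₁ α₂ β₂ θ₂ (zeroExt Ω u)}
  zero_mem' := by
    change IsSolution (Ω : Set Plane) k α₁ β₁ θ₁ α₂ β₂ θ₂ (zeroExt Ω 0)
    rw [zeroExt_zero]
    exact IsSolution.zero _ _ _ _ _ _ _ _
  add_mem' := by
    intro u v hu hv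
    change IsSolution (Ω : Set Plane) k α₁ β₁ θ₁ α₂ β₂ θ₂ (zeroExt Ω (u + v))
    rw [zeroExt_add]
    exact IsSolution.add Ω.isOpen hu hv
  smul_mem' := by
    intro c u hu
    change IsSolution (Ω : Set Plane) k α₁ β₁ θ₁ α₂ β₂ θ₂ (zeroExt Ω (c • u))
    rw [zeroExt_smul]
    exact IsSolution.smul Ω.isOpen c hu

end RobinLines

end

noncomputable section

/-! ### Polar coordinates and Fourier coefficients on circles. -/

namespace RobinLines

open MeasureTheory Metric Set Filter Topology

/-! Upper bound on the dimension. Evaluation at `0` is injective on solutions. Let `u(0) = 0`, and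
let `c_n(r)` be the Fourier coefficients of `u` on the circle of radius `r` about `0`. They solve a
Bessel equation, so a bounded `c_n` is `O(r^|n|)`, and it vanishes if it is `o(r^|n|)`
(`singular_ode_decay`, `singular_ode_eq_zero`). Suppose that all modes of order below `N` vanish,
with `N ≥ 1`. Each Robin condition, expanded in Fourier series, then says that `c_N e^{iNθ} - c_{-N}
e^{-iNθ}` is `O(r^{N+1})`, because the zeroth-order term carries an extra factor `r` and the higher
modes are smaller. The two lines give a linear system of determinant `2i sin(N(θ₁-θ₂)) ≠ 0`, so
`c_{±N} = O(r^{N+1})` and both vanish. Hence `u = 0` near `0` (`eventuallyEq_zero_of_robin`), and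
then on `Ω` by unique continuation (`eqOn_zero_of_eventuallyEq_zero`).

Existence. A solution is sought as an entire series in `z` and `z̄`. The Helmholtz equation leaves
free only the coefficients `A N` of `z^N` and `z̄^N`, and the degree `N` part of the two Robin
conditions determines `A (N+1)` from the earlier ones, after division by `(N+1) sin((N+1)(θ₁-θ₂))`.
Bad approximability keeps the amplification `1/(N |sin(N(θ₁-θ₂))|)` bounded. Moreover,
amplifications above any fixed threshold become arbitrarily sparse, since two of them at nearby
indices would force a small `sin(jΘ)`, `Θ = θ₁-θ₂`, with `j` bounded (`small_denominators_gap`). The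
losses are therefore so rare that `A` decays faster than every geometric sequence
(`superexponential_decay`), and the series defines a solution on the whole plane with value `1` at
`0` (`exists_entire_solution`). -/

theorem norm_direction (θ : ℝ) : ‖direction θ‖ = 1 := by
  rw [direction, EuclideanSpace.norm_eq]
  simp [Fin.sum_univ_two]

theorem hasDerivAt_direction (θ : ℝ) : HasDerivAt direction (normal θ) θ := by
  have h : HasDerivAt (fun t : ℝ => ![Real.cos t, Real.sin t])
      ![-Real.sin θ, Real.cos θ] θ := by
    rw [hasDerivAt_pi]
    intro i
    fin_cases i
    · exact Real.hasDerivAt_cos θ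
    · exact Real.hasDerivAt_sin θ
  exact (EuclideanSpace.equiv (Fin 2) ℝ).symm.hasFDerivAt.comp_hasDerivAt θ h

theorem continuous_direction : Continuous direction :=
  continuous_iff_continuousAt.2 fun θ => (hasDerivAt_direction θ).continuousAt

theorem continuous_normal : Continuous normal := by
  unfold normal
  exact (EuclideanSpace.equiv (Fin 2) ℝ).symm.continuous.comp
    (continuous_pi fun i => by
      fin_cases i
      · exact Real.continuous_sin.neg
      · exact Real.continuous_cos)

theorem direction_add_two_pi (θ : ℝ) : direction (θ + 2 * Real.pi) = direction θ := by
  simp [direction]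

theorem normal_add_two_pi (θ : ℝ) : normal (θ + 2 * Real.pi) = normal θ := by
  simp [normal]

theorem polar_mem_closedBall (x₀ : Plane) {r : ℝ} (hr : 0 ≤ r) (φ : ℝ) :
    x₀ + r • direction φ ∈ closedBall x₀ r := by
  simp [norm_smul, norm_direction, abs_of_nonneg hr]

theorem polar_mem_ball (x₀ : Plane) {r R : ℝ} (hr : 0 ≤ r) (hR : r < R) (φ : ℝ) :
    x₀ + r • direction φ ∈ ball x₀ R :=
  closedBall_subset_ball hR (polar_mem_closedBall x₀ hr φ)

theorem exists_polar (x₀ x : Plane) : ∃ r φ : ℝ, 0 ≤ r ∧ r = dist x x₀ ∧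
    x = x₀ + r • direction φ := by
  set z : ℂ := ⟨(x - x₀) 0, (x - x₀) 1⟩ with hz
  have hnorm : ‖z‖ = dist x x₀ := by
    rw [dist_eq_norm, EuclideanSpace.norm_eq, Complex.norm_def, Complex.normSq_apply,
      Fin.sum_univ_two]
    simp only [Real.norm_eq_abs, sq_abs, hz]
    congr 1
    ring
  refine ⟨‖z‖, z.arg, norm_nonneg z, hnorm, ?_⟩
  ext i
  fin_cases i <;> simp [direction, hz]

theorem hasDerivAt_polar_radius (x₀ : Plane) (φ r : ℝ) :
    HasDerivAt (fun t : ℝ => x₀ + t • direction φ) (direction φ) r := by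
  simpa using ((hasDerivAt_id r).smul_const (direction φ)).const_add x₀

theorem hasDerivAt_polar_angle (x₀ : Plane) (φ r : ℝ) :
    HasDerivAt (fun t : ℝ => x₀ + r • direction t) (r • normal φ) φ := by
  simpa using ((hasDerivAt_direction φ).const_smul r).const_add x₀

theorem continuous_polar_angle (x₀ : Plane) (r : ℝ) :
    Continuous fun φ : ℝ => x₀ + r • direction φ :=
  continuous_const.add (continuous_direction.const_smul r)

/-- The exponential `e^{s n φ}`; for `s = ± i` these are the characters of the circle. -/
def character (s : ℂ) (n : ℕ) (φ : ℝ) : ℂ := Complex.exp (s * n * φ)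

theorem continuous_character (s : ℂ) (n : ℕ) : Continuous (character s n) := by
  unfold character
  fun_prop

theorem hasDerivAt_character (s : ℂ) (n : ℕ) (φ : ℝ) :
    HasDerivAt (character s n) (s * n * character s n φ) φ := by
  have h : HasDerivAt (fun t : ℝ => s * n * (t : ℂ)) (s * n * 1) φ :=
    (Complex.ofRealCLM.hasDerivAt (x := φ)).const_mul (s * n)
  exact h.cexp.congr_deriv (by rw [mul_one, mul_comm, character])

theorem character_zero (s : ℂ) (n : ℕ) : character s n 0 = 1 := by simp [character]

theorem character_two_pi {s : ℂ} (hs : s = Complex.I ∨ s = -Complex.I) (n : ℕ) :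
    character s n (2 * Real.pi) = 1 := by
  unfold character
  rcases hs with rfl | rfl
  · rw [Complex.exp_eq_one_iff]
    exact ⟨n, by push_cast; ring⟩
  · rw [Complex.exp_eq_one_iff]
    exact ⟨-n, by push_cast; ring⟩

theorem norm_character {s : ℂ} (hs : s = Complex.I ∨ s = -Complex.I) (n : ℕ) (φ : ℝ) :
    ‖character s n φ‖ = 1 := by
  unfold character
  rw [Complex.norm_exp]
  rcases hs with rfl | rfl <;> simp

/-- The (unnormalized) Fourier coefficient of `f` on the circle of center `x₀` and radius `r`. -/
def circleCoeff (s : ℂ) (n : ℕ) (x₀ : Plane) (f : Plane → ℂ) (r : ℝ) : ℂ :=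
  ∫ φ in (0 : ℝ)..2 * Real.pi, f (x₀ + r • direction φ) * character s n φ

theorem norm_circleCoeff_le {s : ℂ} (hs : s = Complex.I ∨ s = -Complex.I) (n : ℕ) (x₀ : Plane)
    {f : Plane → ℂ} {r M : ℝ} (hM : ∀ φ, ‖f (x₀ + r • direction φ)‖ ≤ M) :
    ‖circleCoeff s n x₀ f r‖ ≤ M * (2 * Real.pi) := by
  have h := intervalIntegral.norm_integral_le_of_norm_le_const (a := 0) (b := 2 * Real.pi)
    (f := fun φ => f (x₀ + r • direction φ) * character s n φ) (C := M) (fun φ _ => by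
      rw [norm_mul, norm_character hs, mul_one]; exact hM φ)
  rwa [sub_zero, abs_of_pos Real.two_pi_pos] at h

theorem continuous_comp_polar {x₀ : Plane} {R r : ℝ} {E : Type*} [TopologicalSpace E]
    {f : Plane → E} (hf : ContinuousOn f (ball x₀ R)) (hr : 0 ≤ r) (hrR : r < R) :
    Continuous fun φ : ℝ => f (x₀ + r • direction φ) :=
  hf.comp_continuous (continuous_polar_angle x₀ r) fun φ => polar_mem_ball x₀ hr hrR φ

section deriv

variable {x₀ : Plane} {R r : ℝ} {f : Plane → ℂ}

theorem continuousOn_fderiv_ball (hf : ContDiffOn ℝ 1 f (ball x₀ R)) :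
    ContinuousOn (fderiv ℝ f) (ball x₀ R) :=
  hf.continuousOn_fderiv_of_isOpen isOpen_ball le_rfl

theorem hasFDerivAt_of_mem_ball (hf : ContDiffOn ℝ 1 f (ball x₀ R)) {x : Plane}
    (hx : x ∈ ball x₀ R) : HasFDerivAt f (fderiv ℝ f x) x :=
  ((hf.contDiffAt (isOpen_ball.mem_nhds hx)).differentiableAt one_ne_zero).hasFDerivAt

theorem continuous_fderiv_direction (hf : ContDiffOn ℝ 1 f (ball x₀ R)) (hr : 0 ≤ r)
    (hrR : r < R) : Continuous fun φ : ℝ => fderiv ℝ f (x₀ + r • direction φ) (direction φ) :=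
  (continuous_comp_polar (continuousOn_fderiv_ball hf) hr hrR).clm_apply continuous_direction

theorem continuous_fderiv_normal (hf : ContDiffOn ℝ 1 f (ball x₀ R)) (hr : 0 ≤ r)
    (hrR : r < R) : Continuous fun φ : ℝ => fderiv ℝ f (x₀ + r • direction φ) (normal φ) :=
  (continuous_comp_polar (continuousOn_fderiv_ball hf) hr hrR).clm_apply continuous_normal

/-- Integration by parts in the angle; the boundary terms cancel by periodicity. -/
theorem integral_fderiv_normal {s : ℂ} (hs : s = Complex.I ∨ s = -Complex.I) (n : ℕ)
    (hf : ContDiffOn ℝ 1 f (ball x₀ R)) (hr : 0 ≤ r) (hrR : r < R) :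
    r * ∫ φ in (0 : ℝ)..2 * Real.pi,
      fderiv ℝ f (x₀ + r • direction φ) (normal φ) * character s n φ
      = -(s * n * circleCoeff s n x₀ f r) := by
  have h := intervalIntegral.integral_mul_deriv_eq_deriv_mul (a := 0) (b := 2 * Real.pi)
    (u := fun φ => character s n φ) (u' := fun φ => s * n * character s n φ)
    (v := fun φ => f (x₀ + r • direction φ))
    (v' := fun φ => fderiv ℝ f (x₀ + r • direction φ) (r • normal φ))
    (fun φ _ => hasDerivAt_character s n φ)
    (fun φ _ => (hasFDerivAt_of_mem_ball hf (polar_mem_ball x₀ hr hrR φ)).comp_hasDerivAt φ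
      (hasDerivAt_polar_angle x₀ φ r))
    ((continuous_const.mul (continuous_character s n)).intervalIntegrable _ _)
    (((continuous_comp_polar (continuousOn_fderiv_ball hf) hr hrR).clm_apply
      (continuous_normal.const_smul r)).intervalIntegrable _ _)
  have hper : direction (2 * Real.pi) = direction 0 := by
    simpa using direction_add_two_pi 0
  simp only [character_two_pi hs, character_zero, hper, sub_self, zero_sub] at h
  rw [circleCoeff, ← intervalIntegral.integral_const_mul, ← intervalIntegral.integral_const_mul]
  calc _ = _ := intervalIntegral.integral_congr fun φ _ => by
        simp only [map_smul, Complex.real_smul]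
        ring
    _ = _ := h
    _ = _ := by
        congr 1
        exact intervalIntegral.integral_congr fun φ _ => by ring

theorem hasDerivAt_circleCoeff_radius (s : ℂ) (hs : s = Complex.I ∨ s = -Complex.I) (n : ℕ)
    (hf : ContDiffOn ℝ 1 f (ball x₀ R)) (hr : 0 < r) (hrR : r < R) :
    HasDerivAt (circleCoeff s n x₀ f) (∫ φ in (0 : ℝ)..2 * Real.pi,
      fderiv ℝ f (x₀ + r • direction φ) (direction φ) * character s n φ) r := by
  obtain ⟨r₁, hr₁, hr₁R⟩ := exists_between hrR
  obtain ⟨M, hM⟩ := (isCompact_closedBall x₀ r₁).exists_bound_of_continuousOn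
    ((continuousOn_fderiv_ball hf).mono (closedBall_subset_ball hr₁R))
  have hmem : ∀ t ∈ Ioo 0 r₁, ∀ φ, x₀ + t • direction φ ∈ closedBall x₀ r₁ := fun t ht φ =>
    closedBall_subset_closedBall ht.2.le (polar_mem_closedBall x₀ ht.1.le φ)
  refine (intervalIntegral.hasDerivAt_integral_of_dominated_loc_of_deriv_le
    (F := fun t φ => f (x₀ + t • direction φ) * character s n φ)
    (F' := fun t φ => fderiv ℝ f (x₀ + t • direction φ) (direction φ) * character s n φ)
    (s := Ioo 0 r₁) (bound := fun _ => M) (Ioo_mem_nhds hr hr₁) ?_ ?_ ?_ ?_ ?_ ?_).2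
  · filter_upwards [Ioo_mem_nhds hr hr₁] with t ht
    exact ((continuous_comp_polar hf.continuousOn ht.1.le (ht.2.trans hr₁R)).mul
      (continuous_character s n)).aestronglyMeasurable
  · exact ((continuous_comp_polar hf.continuousOn hr.le hrR).mul
      (continuous_character s n)).intervalIntegrable _ _
  · exact ((continuous_fderiv_direction hf hr.le hrR).mul
      (continuous_character s n)).aestronglyMeasurable
  · refine Eventually.of_forall fun φ _ t ht => ?_
    rw [norm_mul, norm_character hs, mul_one]
    refine ((fderiv ℝ f _).le_opNorm _).trans ?_
    rw [norm_direction, mul_one]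
    exact hM _ (hmem t ht φ)
  · exact intervalIntegrable_const
  · refine Eventually.of_forall fun φ _ t ht => ?_
    exact ((hasFDerivAt_of_mem_ball hf (closedBall_subset_ball hr₁R
      (hmem t ht φ))).comp_hasDerivAt t (hasDerivAt_polar_radius x₀ φ t)).mul_const _

/-- The angular derivative integrates to a multiple of the coefficient itself, so any multiple `σ`
of it may be added under the integral and compensated outside. The values `σ = ∓ s` turn the
gradient term into a Wirtinger derivative. -/
theorem hasDerivAt_circleCoeff {s : ℂ} (hs : s = Complex.I ∨ s = -Complex.I) (σ : ℂ) (n : ℕ)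
    (hf : ContDiffOn ℝ 1 f (ball x₀ R)) (hr : 0 < r) (hrR : r < R) :
    HasDerivAt (circleCoeff s n x₀ f) ((∫ φ in (0 : ℝ)..2 * Real.pi,
      (fderiv ℝ f (x₀ + r • direction φ) (direction φ)
        + σ * fderiv ℝ f (x₀ + r • direction φ) (normal φ)) * character s n φ)
      + σ * s * n * circleCoeff s n x₀ f r / r) r := by
  convert! hasDerivAt_circleCoeff_radius s hs n hf hr hrR using 1
  have h1 := integral_fderiv_normal hs n hf hr.le hrR
  have hr0 : (r : ℂ) ≠ 0 := by exact_mod_cast hr.ne'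
  have h2 : (∫ φ in (0 : ℝ)..2 * Real.pi,
      (fderiv ℝ f (x₀ + r • direction φ) (direction φ)
        + σ * fderiv ℝ f (x₀ + r • direction φ) (normal φ)) * character s n φ)
      = (∫ φ in (0 : ℝ)..2 * Real.pi,
        fderiv ℝ f (x₀ + r • direction φ) (direction φ) * character s n φ)
      + σ * ∫ φ in (0 : ℝ)..2 * Real.pi,
        fderiv ℝ f (x₀ + r • direction φ) (normal φ) * character s n φ := by
    rw [← intervalIntegral.integral_const_mul, ← intervalIntegral.integral_add]
    · exact intervalIntegral.integral_congr fun φ _ => by ring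
    · exact ((continuous_fderiv_direction hf hr.le hrR).mul
        (continuous_character s n)).intervalIntegrable _ _
    · exact (continuous_const.mul ((continuous_fderiv_normal hf hr.le hrR).mul
        (continuous_character s n))).intervalIntegrable _ _
  rw [h2]
  field_simp
  linear_combination σ * h1

end deriv

end RobinLines

/-! ### The Bessel equation as a first-order system. -/

namespace RobinLines

open MeasureTheory Metric Set Filter Topology

/-- The first vector of the canonical basis of the plane. -/
def e₁ : Plane := EuclideanSpace.basisFun (Fin 2) ℝ 0

/-- The second vector of the canonical basis of the plane. -/
def e₂ : Plane := EuclideanSpace.basisFun (Fin 2) ℝ 1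

theorem direction_eq (φ : ℝ) : direction φ = Real.cos φ • e₁ + Real.sin φ • e₂ := by
  ext i
  fin_cases i <;> simp [direction, e₁, e₂]

theorem normal_eq (φ : ℝ) : normal φ = -Real.sin φ • e₁ + Real.cos φ • e₂ := by
  ext i
  fin_cases i <;> simp [normal, e₁, e₂]

theorem laplacian_eq_fderiv_fderiv {u : Plane → ℂ} {x : Plane} :
    Laplacian.laplacian u x
      = fderiv ℝ (fderiv ℝ u) x e₁ e₁ + fderiv ℝ (fderiv ℝ u) x e₂ e₂ := by
  rw [InnerProductSpace.laplacian_eq_iteratedFDeriv_orthonormalBasis u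
    (EuclideanSpace.basisFun (Fin 2) ℝ)]
  simp only [Fin.sum_univ_two, iteratedFDeriv_two_apply, Matrix.cons_val_zero,
    Matrix.cons_val_one, e₁, e₂]

/-- For `s = ± i`, twice a Wirtinger derivative: `∂u/∂x - s ∂u/∂y`. -/
def wirtinger (s : ℂ) (u : Plane → ℂ) (x : Plane) : ℂ := fderiv ℝ u x e₁ - s * fderiv ℝ u x e₂

theorem character_one_eq {s : ℂ} (hs : s = Complex.I ∨ s = -Complex.I) (φ : ℝ) :
    character s 1 φ = Real.cos φ + s * Real.sin φ := by
  unfold character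
  rcases hs with rfl | rfl
  · rw [Nat.cast_one, mul_one, mul_comm, Complex.exp_mul_I]
    push_cast
    ring
  · rw [Nat.cast_one, mul_one, neg_mul, ← mul_neg, mul_comm, Complex.exp_mul_I]
    push_cast
    rw [Complex.cos_neg, Complex.sin_neg]
    ring

theorem character_succ (s : ℂ) (n : ℕ) (φ : ℝ) :
    character s (n + 1) φ = character s n φ * character s 1 φ := by
  unfold character
  rw [← Complex.exp_add]
  push_cast
  ring_nf

theorem sq_eq_neg_one {s : ℂ} (hs : s = Complex.I ∨ s = -Complex.I) : s * s = -1 := by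
  rcases hs with rfl | rfl <;> simp

theorem cos_sq_add_sin_sq_complex (φ : ℝ) :
    (Real.cos φ : ℂ) ^ 2 + (Real.sin φ : ℂ) ^ 2 = 1 := by
  exact_mod_cast Real.cos_sq_add_sin_sq φ

section system

variable {x₀ : Plane} {R r : ℝ} {u : Plane → ℂ} {k : ℝ}

theorem contDiffOn_fderiv_ball (hu : ContDiffOn ℝ 2 u (ball x₀ R)) :
    ContDiffOn ℝ 1 (fderiv ℝ u) (ball x₀ R) :=
  hu.fderiv_of_isOpen isOpen_ball (by norm_num)

theorem contDiffOn_wirtinger (s : ℂ) (hu : ContDiffOn ℝ 2 u (ball x₀ R)) :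
    ContDiffOn ℝ 1 (wirtinger s u) (ball x₀ R) :=
  ((contDiffOn_fderiv_ball hu).clm_apply contDiffOn_const).sub
    (contDiffOn_const.mul ((contDiffOn_fderiv_ball hu).clm_apply contDiffOn_const))

theorem fderiv_wirtinger (s : ℂ) (hu : ContDiffOn ℝ 2 u (ball x₀ R)) {x : Plane}
    (hx : x ∈ ball x₀ R) (v : Plane) :
    fderiv ℝ (wirtinger s u) x v
      = fderiv ℝ (fderiv ℝ u) x v e₁ - s * fderiv ℝ (fderiv ℝ u) x v e₂ := by
  have h : HasFDerivAt (fderiv ℝ u) (fderiv ℝ (fderiv ℝ u) x) x :=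
    (((contDiffOn_fderiv_ball hu).contDiffAt
      (isOpen_ball.mem_nhds hx)).differentiableAt one_ne_zero).hasFDerivAt
  have h1 := h.clm_apply (hasFDerivAt_const e₁ x)
  have h2 := (h.clm_apply (hasFDerivAt_const e₂ x)).const_mul s
  have h3 : HasFDerivAt (wirtinger s u) _ x := h1.sub h2
  rw [h3.fderiv]
  simp

/-- The two conjugate Wirtinger operators factor the Laplacian, because `s² = -1` and second
derivatives commute. -/
theorem wirtinger_wirtinger {s : ℂ} (hs : s = Complex.I ∨ s = -Complex.I)
    (hu : ContDiffOn ℝ 2 u (ball x₀ R)) {x : Plane} (hx : x ∈ ball x₀ R) :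
    fderiv ℝ (wirtinger s u) x e₁ + s * fderiv ℝ (wirtinger s u) x e₂
      = Laplacian.laplacian u x := by
  have hsymm : fderiv ℝ (fderiv ℝ u) x e₁ e₂ = fderiv ℝ (fderiv ℝ u) x e₂ e₁ :=
    ((hu.contDiffAt (isOpen_ball.mem_nhds hx)).isSymmSndFDerivAt (by simp)) e₁ e₂
  rw [fderiv_wirtinger s hu hx, fderiv_wirtinger s hu hx, laplacian_eq_fderiv_fderiv, hsymm]
  linear_combination (-fderiv ℝ (fderiv ℝ u) x e₂ e₂) * sq_eq_neg_one hs

/-- With `σ = -s`, the combination `∂_r - s ∂_n` equals `e^{sφ}(∂_x - s ∂_y)`; the factor `e^{sφ}`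
raises the order of the character by one. -/
theorem hasDerivAt_circleCoeff_solution {s : ℂ} (hs : s = Complex.I ∨ s = -Complex.I) (m : ℕ)
    (hu : ContDiffOn ℝ 2 u (ball x₀ R)) (hr : 0 < r) (hrR : r < R) :
    HasDerivAt (circleCoeff s m x₀ u) (circleCoeff s (m + 1) x₀ (wirtinger s u) r
      + m * circleCoeff s m x₀ u r / r) r := by
  refine (hasDerivAt_circleCoeff hs (-s) m (hu.of_le one_le_two) hr hrR).congr_deriv ?_
  rw [neg_mul, sq_eq_neg_one hs, neg_neg, one_mul]
  congr 1
  refine intervalIntegral.integral_congr fun φ _ => ?_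
  simp only [wirtinger, character_succ s m, character_one_eq hs, direction_eq, normal_eq, map_add,
    map_smul, Complex.real_smul]
  push_cast
  linear_combination (fderiv ℝ u (x₀ + r • (Real.cos φ • e₁ + Real.sin φ • e₂)) e₂ *
    character s m φ * Complex.sin φ) * sq_eq_neg_one hs

/-- With `σ = s`, the factor `e^{-sφ}` lowers the order back to `m`, and the remaining operator
applied to `wirtinger s u` is the Laplacian, that is `-k² u`. -/
theorem hasDerivAt_circleCoeff_wirtinger {s : ℂ} (hs : s = Complex.I ∨ s = -Complex.I) (m : ℕ)
    (hu : ContDiffOn ℝ 2 u (ball x₀ R))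
    (hΔ : ∀ x ∈ ball x₀ R, Laplacian.laplacian u x + k ^ 2 • u x = 0)
    (hr : 0 < r) (hrR : r < R) :
    HasDerivAt (circleCoeff s (m + 1) x₀ (wirtinger s u)) (-(k ^ 2 * circleCoeff s m x₀ u r)
      - (m + 1) * circleCoeff s (m + 1) x₀ (wirtinger s u) r / r) r := by
  refine (hasDerivAt_circleCoeff hs s (m + 1) (contDiffOn_wirtinger s hu) hr hrR).congr_deriv ?_
  rw [sq_eq_neg_one hs]
  have h : ∀ φ : ℝ, (fderiv ℝ (wirtinger s u) (x₀ + r • direction φ) (direction φ)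
        + s * fderiv ℝ (wirtinger s u) (x₀ + r • direction φ) (normal φ)) * character s (m + 1) φ
      = -(k ^ 2 : ℂ) * (u (x₀ + r • direction φ) * character s m φ) := by
    intro φ
    have hx := polar_mem_ball x₀ hr.le hrR φ
    have h1 := wirtinger_wirtinger hs hu hx
    have h2 := hΔ _ hx
    rw [Complex.real_smul] at h2
    push_cast at h2
    generalize x₀ + r • direction φ = x at h1 h2 ⊢
    simp only [character_succ s m, character_one_eq hs, direction_eq, normal_eq, map_add,
      map_smul, Complex.real_smul]
    push_cast
    have h3 := cos_sq_add_sin_sq_complex φ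
    have h4 := sq_eq_neg_one hs
    push_cast at h3
    linear_combination character s m φ * (h1 + h2
      + (fderiv ℝ (wirtinger s u) x e₁ + s * fderiv ℝ (wirtinger s u) x e₂) * h3
      + (fderiv ℝ (wirtinger s u) x e₂ * Complex.sin φ * Complex.cos φ
        - fderiv ℝ (wirtinger s u) x e₁ * Complex.sin φ ^ 2) * h4)
  simp only [h]
  rw [intervalIntegral.integral_const_mul, ← circleCoeff]
  push_cast
  ring

end system

/-! ### Behaviour at the origin of bounded solutions of the singular system. -/

section ode

variable {c P : ℝ → ℂ} {R k M A δ : ℝ} {m : ℕ}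

/-- The function `r^(m+1) P` has derivative `-k² r^(m+1) c` and tends to `0` at the origin because
`P` is bounded, so the mean value inequality controls it. The parameter `δ` permits a bound on `c`
that is known to be finite before any decay is proved. -/
theorem singular_ode_norm_le
    (hP : ∀ r ∈ Ioc 0 R, HasDerivAt P (-(k ^ 2 * c r) - (m + 1) * P r / r) r)
    (hM : ∀ r ∈ Ioc 0 R, ‖P r‖ ≤ M) (hA : 0 ≤ A) (hδ : 0 ≤ δ)
    (hcA : ∀ r ∈ Ioc 0 R, ‖c r‖ ≤ A * (r ^ m + δ)) {t : ℝ} (ht : t ∈ Ioc 0 R) :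
    ‖P t‖ ≤ k ^ 2 * t * (A * (t ^ m + δ)) := by
  have ht0 := ht.1
  set B := k ^ 2 * t ^ (m + 1) * (A * (t ^ m + δ)) with hB
  have hB0 : 0 ≤ B := by positivity
  have hG : ∀ τ ∈ Ioc 0 t, HasDerivAt (fun r : ℝ => (r : ℂ) ^ (m + 1) * P r)
      (-(k ^ 2 * (τ : ℂ) ^ (m + 1) * c τ)) τ := by
    intro τ hτ
    have hτ0 : (τ : ℂ) ≠ 0 := by exact_mod_cast hτ.1.ne'
    have h1 : HasDerivAt (fun r : ℝ => (r : ℂ) ^ (m + 1)) ((m + 1 : ℂ) * (τ : ℂ) ^ m) τ := by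
      simpa using (hasDerivAt_pow (m + 1) (τ : ℂ)).comp_ofReal
    refine (h1.mul (hP τ ⟨hτ.1, hτ.2.trans ht.2⟩)).congr_deriv ?_
    field_simp
    ring
  have hmain : ∀ τ ∈ Ioo 0 t, ‖(t : ℂ) ^ (m + 1) * P t‖ ≤ B * t + τ ^ (m + 1) * M := by
    intro τ hτ
    have h := (convex_Icc τ t).norm_image_sub_le_of_norm_hasDerivWithin_le (C := B)
      (f := fun r : ℝ => (r : ℂ) ^ (m + 1) * P r)
      (f' := fun τ => -(k ^ 2 * (τ : ℂ) ^ (m + 1) * c τ))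
      (fun y hy => (hG y ⟨hτ.1.trans_le hy.1, hy.2⟩).hasDerivWithinAt)
      (fun y hy => by
        have hy0 : 0 < y := hτ.1.trans_le hy.1
        rw [norm_neg, norm_mul, norm_mul, norm_pow, norm_pow, Complex.norm_real, Complex.norm_real,
          Real.norm_eq_abs, Real.norm_eq_abs, sq_abs, abs_of_pos hy0, hB]
        have h1 := hcA y ⟨hy0, hy.2.trans ht.2⟩
        have h2 : A * (y ^ m + δ) ≤ A * (t ^ m + δ) := by
          gcongr
          exact hy.2
        have h3 : y ^ (m + 1) ≤ t ^ (m + 1) := pow_le_pow_left₀ hy0.le hy.2 _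
        gcongr
        exact h1.trans h2)
      (left_mem_Icc.2 hτ.2.le) (right_mem_Icc.2 hτ.2.le)
    have h1 : B * ‖t - τ‖ ≤ B * t := by
      rw [Real.norm_eq_abs, abs_of_pos (sub_pos.2 hτ.2)]
      exact mul_le_mul_of_nonneg_left (by linarith [hτ.1]) hB0
    have h2 : ‖(τ : ℂ) ^ (m + 1) * P τ‖ ≤ τ ^ (m + 1) * M := by
      rw [norm_mul, norm_pow, Complex.norm_real, Real.norm_eq_abs, abs_of_pos hτ.1]
      exact mul_le_mul_of_nonneg_left (hM τ ⟨hτ.1, hτ.2.le.trans ht.2⟩) (pow_nonneg hτ.1.le _)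
    have h3 := norm_sub_norm_le ((t : ℂ) ^ (m + 1) * P t) ((τ : ℂ) ^ (m + 1) * P τ)
    linarith
  have hlim : Tendsto (fun τ : ℝ => B * t + τ ^ (m + 1) * M) (𝓝[>] 0) (𝓝 (B * t)) := by
    have h : Continuous fun τ : ℝ => B * t + τ ^ (m + 1) * M := by fun_prop
    have h1 := (h.tendsto 0).mono_left (nhdsWithin_le_nhds (s := Ioi 0))
    simpa using h1
  have hle : ‖(t : ℂ) ^ (m + 1) * P t‖ ≤ B * t :=
    ge_of_tendsto hlim (by
      filter_upwards [Ioo_mem_nhdsGT ht0] with τ hτ using hmain τ hτ)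
  rw [norm_mul, norm_pow, Complex.norm_real, Real.norm_eq_abs, abs_of_pos ht0] at hle
  have hpos : 0 < t ^ (m + 1) := pow_pos ht0 _
  refine le_of_mul_le_mul_left (hle.trans_eq ?_) hpos
  rw [hB]
  ring

/-- Since `c / r^m` has derivative `P / r^m`, its oscillation is at most `k² R²` times the assumed
bound. The smallness of `k² R²` yields the factor `1/2` that makes absorption possible. -/
theorem singular_ode_norm_sub_le (hkR : k ^ 2 * R ^ 2 ≤ 1 / 2)
    (hc : ∀ r ∈ Ioc 0 R, HasDerivAt c (P r + m * c r / r) r)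
    (hP : ∀ r ∈ Ioc 0 R, HasDerivAt P (-(k ^ 2 * c r) - (m + 1) * P r / r) r)
    (hM : ∀ r ∈ Ioc 0 R, ‖P r‖ ≤ M) (hA : 0 ≤ A) (hδ : 0 ≤ δ)
    (hcA : ∀ r ∈ Ioc 0 R, ‖c r‖ ≤ A * (r ^ m + δ)) {r s : ℝ} (hr : 0 < r) (hrs : r ≤ s)
    (hs : s ≤ R) :
    ‖c r / r ^ m - c s / s ^ m‖ ≤ A / 2 * (1 + δ / r ^ m) := by
  have hR : 0 < R := hr.trans_le (hrs.trans hs)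
  have hF : ∀ t ∈ Icc r s, HasDerivAt (fun y : ℝ => c y / (y : ℂ) ^ m) (P t / (t : ℂ) ^ m) t := by
    intro t ht
    have ht0 : 0 < t := hr.trans_le ht.1
    have ht1 : (t : ℂ) ≠ 0 := by exact_mod_cast ht0.ne'
    have h1 : HasDerivAt (fun y : ℝ => (y : ℂ) ^ m) ((m : ℂ) * (t : ℂ) ^ (m - 1)) t :=
      (hasDerivAt_pow m (t : ℂ)).comp_ofReal
    refine ((hc t ⟨ht0, ht.2.trans hs⟩).div h1 (pow_ne_zero m ht1)).congr_deriv ?_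
    rcases m with _ | m
    · simp
    · simp only [Nat.add_sub_cancel]
      field_simp
      push_cast
      ring
  have hbd : ∀ t ∈ Icc r s, ‖P t / (t : ℂ) ^ m‖ ≤ k ^ 2 * R * (A * (1 + δ / r ^ m)) := by
    intro t ht
    have ht0 : 0 < t := hr.trans_le ht.1
    have h1 := singular_ode_norm_le hP hM hA hδ hcA ⟨ht0, ht.2.trans hs⟩
    rw [norm_div, norm_pow, Complex.norm_real, Real.norm_eq_abs, abs_of_pos ht0]
    have h2 : k ^ 2 * t * (A * (t ^ m + δ)) / t ^ m = k ^ 2 * t * (A * (1 + δ / t ^ m)) := by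
      have : t ^ m ≠ 0 := (pow_pos ht0 m).ne'
      field_simp
    refine (div_le_div_of_nonneg_right h1 (pow_pos ht0 m).le).trans (h2.trans_le ?_)
    have h3 : r ^ m ≤ t ^ m := pow_le_pow_left₀ hr.le ht.1 m
    have h4 : 0 < r ^ m := pow_pos hr m
    have h5 : t ≤ R := ht.2.trans hs
    gcongr
  have h := (convex_Icc r s).norm_image_sub_le_of_norm_hasDerivWithin_le
    (fun y hy => (hF y hy).hasDerivWithinAt) hbd (right_mem_Icc.2 hrs) (left_mem_Icc.2 hrs)
  refine h.trans ?_
  have h6 : 0 ≤ A * (1 + δ / r ^ m) := by positivity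
  have h7 : ‖r - s‖ ≤ R := by
    rw [Real.norm_eq_abs, abs_sub_comm, abs_of_nonneg (sub_nonneg.2 hrs)]
    linarith
  calc _ ≤ k ^ 2 * R * (A * (1 + δ / r ^ m)) * R := by gcongr
    _ = k ^ 2 * R ^ 2 * (A * (1 + δ / r ^ m)) := by ring
    _ ≤ 1 / 2 * (A * (1 + δ / r ^ m)) := by gcongr
    _ = _ := by ring

/-- Absorption: the supremum is finite and at most `B` plus half of itself. -/
theorem le_of_forall_le_half {S : Set ℝ} (hS : BddAbove S) {B : ℝ} (hB : 0 ≤ B)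
    (h : ∀ A, 0 ≤ A → (∀ y ∈ S, y ≤ A) → ∀ y ∈ S, y ≤ B + A / 2) : ∀ y ∈ S, y ≤ 2 * B := by
  intro y hy
  rcases le_or_gt y 0 with h0 | h0
  · linarith
  have h1 : y ≤ sSup S := le_csSup hS hy
  have h2 : sSup S ≤ B + sSup S / 2 :=
    csSup_le ⟨y, hy⟩ (h _ (h0.le.trans h1) fun z hz => le_csSup hS hz)
  linarith

/-- Absorption is applied to `‖c‖ / (r^m + δ)`, which is bounded for `δ > 0`, by comparison with the
endpoint `R`. The resulting bound is uniform in `δ`, and `δ` tends to `0`. -/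
theorem singular_ode_decay (hkR : k ^ 2 * R ^ 2 ≤ 1 / 2)
    (hc : ∀ r ∈ Ioc 0 R, HasDerivAt c (P r + m * c r / r) r)
    (hP : ∀ r ∈ Ioc 0 R, HasDerivAt P (-(k ^ 2 * c r) - (m + 1) * P r / r) r)
    (hM : ∀ r ∈ Ioc 0 R, ‖P r‖ ≤ M) (hM' : ∀ r ∈ Ioc 0 R, ‖c r‖ ≤ M) :
    ∀ r ∈ Ioc 0 R, ‖c r‖ ≤ 2 * M * (r / R) ^ m := by
  intro r hr
  have hR : 0 < R := hr.1.trans_le hr.2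
  have hM0 : 0 ≤ M := (norm_nonneg _).trans (hM r hr)
  have key : ∀ δ > 0, ‖c r‖ ≤ 2 * (M / R ^ m) * (r ^ m + δ) := by
    intro δ hδ
    have hpos : ∀ t ∈ Ioc 0 R, 0 < t ^ m + δ := fun t ht => by
      have := pow_pos ht.1 m
      positivity
    have h := le_of_forall_le_half (S := (fun t => ‖c t‖ / (t ^ m + δ)) '' Ioc 0 R)
      (B := M / R ^ m) ?_ (by positivity) ?_ _ (mem_image_of_mem _ hr)
    · rwa [div_le_iff₀ (hpos r hr)] at h
    · refine ⟨M / δ, ?_⟩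
      rintro _ ⟨t, ht, rfl⟩
      have := pow_pos ht.1 m
      exact div_le_div₀ hM0 (hM' t ht) hδ (by linarith)
    · rintro A hA hAS _ ⟨t, ht, rfl⟩
      have hcA : ∀ y ∈ Ioc 0 R, ‖c y‖ ≤ A * (y ^ m + δ) := fun y hy =>
        (div_le_iff₀ (hpos y hy)).1 (hAS _ (mem_image_of_mem _ hy))
      have h1 := singular_ode_norm_sub_le hkR hc hP hM hA hδ.le hcA ht.1 ht.2 le_rfl
      have htm : 0 < t ^ m := pow_pos ht.1 m
      have h2 := norm_le_insert' (c t / t ^ m) (c R / R ^ m)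
      simp only [norm_div, norm_pow, Complex.norm_real, Real.norm_eq_abs, abs_of_pos ht.1,
        abs_of_pos hR] at h2
      have h3 : ‖c R‖ / R ^ m ≤ M / R ^ m := by
        gcongr
        exact hM' R ⟨hR, le_rfl⟩
      have h4 : ‖c t‖ / t ^ m ≤ M / R ^ m + A / 2 * (1 + δ / t ^ m) := by linarith
      rw [div_le_iff₀ htm] at h4
      rw [div_le_iff₀ (hpos t ht)]
      have h5 : (M / R ^ m + A / 2 * (1 + δ / t ^ m)) * t ^ m
          = M / R ^ m * t ^ m + A / 2 * (t ^ m + δ) := by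
        field_simp
      have h6 : 0 ≤ M / R ^ m * δ := by positivity
      linarith
  have hlim : Tendsto (fun δ : ℝ => 2 * (M / R ^ m) * (r ^ m + δ)) (𝓝[>] 0)
      (𝓝 (2 * (M / R ^ m) * (r ^ m + 0))) := by
    have h : Continuous fun δ : ℝ => 2 * (M / R ^ m) * (r ^ m + δ) := by fun_prop
    exact (h.tendsto 0).mono_left nhdsWithin_le_nhds
  have h := ge_of_tendsto hlim (by filter_upwards [self_mem_nhdsWithin] with δ hδ using key δ hδ)
  refine h.trans_eq ?_
  rw [div_pow]
  ring

/-- By `singular_ode_decay` the quotient `‖c‖ / r^m` is bounded, so `δ = 0` is now allowed.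
Comparison with the origin, where the quotient tends to `0`, gives absorption with `B = 0`. -/
theorem singular_ode_eq_zero (hkR : k ^ 2 * R ^ 2 ≤ 1 / 2)
    (hc : ∀ r ∈ Ioc 0 R, HasDerivAt c (P r + m * c r / r) r)
    (hP : ∀ r ∈ Ioc 0 R, HasDerivAt P (-(k ^ 2 * c r) - (m + 1) * P r / r) r)
    (hM : ∀ r ∈ Ioc 0 R, ‖P r‖ ≤ M) (hM' : ∀ r ∈ Ioc 0 R, ‖c r‖ ≤ M)
    (hlim : Tendsto (fun r : ℝ => ‖c r‖ / r ^ m) (𝓝[>] 0) (𝓝 0)) :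
    ∀ r ∈ Ioc 0 R, c r = 0 := by
  intro r hr
  have hR : 0 < R := hr.1.trans_le hr.2
  have h := le_of_forall_le_half (S := (fun t => ‖c t‖ / t ^ m) '' Ioc 0 R)
      (B := 0) ?_ le_rfl ?_ _ (mem_image_of_mem _ hr)
  · have h1 : 0 < r ^ m := pow_pos hr.1 m
    rw [div_le_iff₀ h1] at h
    exact norm_le_zero_iff.1 (by simpa using h)
  · refine ⟨2 * M / R ^ m, ?_⟩
    rintro _ ⟨t, ht, rfl⟩
    rw [div_le_iff₀ (pow_pos ht.1 m)]
    refine (singular_ode_decay hkR hc hP hM hM' t ht).trans_eq ?_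
    rw [div_pow]
    ring
  · rintro A hA hAS _ ⟨t, ht, rfl⟩
    have hcA : ∀ y ∈ Ioc 0 R, ‖c y‖ ≤ A * (y ^ m + 0) := fun y hy => by
      rw [add_zero]
      exact (div_le_iff₀ (pow_pos hy.1 m)).1 (hAS _ (mem_image_of_mem _ hy))
    have key : ∀ y ∈ Ioo 0 t, ‖c t‖ / t ^ m ≤ ‖c y‖ / y ^ m + A / 2 := by
      intro y hy
      have h1 := singular_ode_norm_sub_le hkR hc hP hM hA le_rfl hcA hy.1 hy.2.le ht.2
      have h2 := norm_le_insert (c y / y ^ m) (c t / t ^ m)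
      simp only [norm_div, norm_pow, Complex.norm_real, Real.norm_eq_abs, abs_of_pos ht.1,
        abs_of_pos hy.1] at h2
      simp only [zero_div, add_zero, mul_one] at h1
      linarith
    exact ge_of_tendsto (hlim.add_const (A / 2)) (by
      filter_upwards [Ioo_mem_nhdsGT ht.1] with y hy using key y hy)

end ode

end RobinLines

/-! ### Fourier series on circles and unique continuation. -/

namespace RobinLines

open MeasureTheory Metric Set Filter Topology

/-- The sign `∓ i` such that `e^{-i n φ} = character (signI n) |n| φ`. -/
def signI (n : ℤ) : ℂ := if 0 ≤ n then -Complex.I else Complex.I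

theorem signI_eq_or (n : ℤ) : signI n = Complex.I ∨ signI n = -Complex.I := by
  unfold signI
  split_ifs
  · exact Or.inr rfl
  · exact Or.inl rfl

theorem signI_mul_natAbs (n : ℤ) : signI n * n.natAbs = -(n * Complex.I) := by
  have h : ((n.natAbs : ℤ) : ℂ) = ((|n| : ℤ) : ℂ) := by rw [Int.natCast_natAbs]
  rw [Int.cast_natCast] at h
  rw [h, signI]
  split_ifs with h0
  · rw [abs_of_nonneg h0]
    ring
  · rw [abs_of_neg (not_le.1 h0)]
    push_cast
    ring

theorem character_signI (n : ℤ) (φ : ℝ) :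
    character (signI n) n.natAbs φ = Complex.exp (-(n * Complex.I * φ)) := by
  rw [character, signI_mul_natAbs, neg_mul]

theorem hasSum_fourierSeries {g : ℝ → ℂ} (hg : Continuous g)
    (hper : ∀ φ, g (φ + 2 * Real.pi) = g φ)
    (hsum : Summable fun n : ℤ =>
      ∫ φ in (0 : ℝ)..2 * Real.pi, g φ * character (signI n) n.natAbs φ) (φ : ℝ) :
    HasSum (fun n : ℤ => (2 * Real.pi : ℂ)⁻¹ *
      (∫ φ in (0 : ℝ)..2 * Real.pi, g φ * character (signI n) n.natAbs φ)
        * Complex.exp (n * Complex.I * φ)) (g φ) := by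
  have : Fact (0 < 2 * Real.pi) := ⟨Real.two_pi_pos⟩
  have hp : Function.Periodic g (2 * Real.pi) := hper
  have hcont : Continuous (hp.lift : AddCircle (2 * Real.pi) → ℂ) :=
    continuous_quot_lift _ hg
  set f : C(AddCircle (2 * Real.pi), ℂ) := ⟨hp.lift, hcont⟩ with hf
  have hfc : ∀ t : ℝ, f (t : AddCircle (2 * Real.pi)) = g t := fun t => rfl
  have hπ : (Real.pi : ℂ) ≠ 0 := by exact_mod_cast Real.pi_ne_zero
  have hfour : ∀ (n : ℤ) (t : ℝ), (fourier n (t : AddCircle (2 * Real.pi)) : ℂ)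
      = Complex.exp (n * Complex.I * t) := by
    intro n t
    rw [fourier_coe_apply]
    congr 1
    push_cast
    field_simp
  have hcoef : ∀ n : ℤ, fourierCoeff f n = (2 * Real.pi : ℂ)⁻¹ *
      (∫ φ in (0 : ℝ)..2 * Real.pi, g φ * character (signI n) n.natAbs φ) := by
    intro n
    rw [fourierCoeff_eq_intervalIntegral _ n 0, zero_add, Complex.real_smul]
    congr 1
    · push_cast
      rw [one_div]
    · refine intervalIntegral.integral_congr fun t _ => ?_
      rw [hfour, hfc, character_signI, smul_eq_mul, mul_comm]
      push_cast
      ring_nf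
  have h := has_pointwise_sum_fourier_series_of_summable (f := f)
    (by
      have : fourierCoeff f = fun n => fourierCoeff f n := rfl
      rw [this]
      simp only [hcoef]
      exact hsum.mul_left _) (φ : AddCircle (2 * Real.pi))
  rw [hfc] at h
  convert! h using 2 with n
  rw [hcoef, hfour, smul_eq_mul]

theorem eq_zero_of_circleCoeff_eq_zero {x₀ : Plane} {R : ℝ} {u : Plane → ℂ}
    (hu : ContinuousOn u (ball x₀ R))
    (h : ∀ s : ℂ, s = Complex.I ∨ s = -Complex.I → ∀ n : ℕ, ∀ r ∈ Ioo 0 R,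
      circleCoeff s n x₀ u r = 0) {x : Plane} (hx : x ∈ ball x₀ R) (hne : x ≠ x₀) : u x = 0 := by
  obtain ⟨r, φ, -, hr, rfl⟩ := exists_polar x₀ x
  have hr0 : 0 < r := by
    rw [hr]
    exact dist_pos.2 hne
  have hrR : r < R := by
    rw [hr]
    exact hx
  have hz : ∀ n : ℤ, ∫ φ in (0 : ℝ)..2 * Real.pi,
      u (x₀ + r • direction φ) * character (signI n) n.natAbs φ = 0 := fun n =>
    h _ (signI_eq_or n) n.natAbs r ⟨hr0, hrR⟩
  have hs := hasSum_fourierSeries (continuous_comp_polar hu hr0.le hrR)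
    (fun φ => by rw [direction_add_two_pi]) (by
      simp only [hz]
      exact summable_zero) φ
  simp only [hz, mul_zero, zero_mul] at hs
  exact (hasSum_zero.unique hs).symm

/-- Both components of the system vanish at some radius `a > 0` inside the neighbourhood where `u =
0`. The system is regular on `[a, r]`, so Grönwall's inequality propagates the zero to every larger
circle. -/
theorem eq_zero_on_ball {x₀ : Plane} {R k : ℝ} {u : Plane → ℂ}
    (hu : ContDiffOn ℝ 2 u (ball x₀ R))
    (hΔ : ∀ x ∈ ball x₀ R, Laplacian.laplacian u x + k ^ 2 • u x = 0)
    (h0 : u =ᶠ[𝓝 x₀] 0) {x : Plane} (hx : x ∈ ball x₀ R) : u x = 0 := by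
  by_cases hne : x = x₀
  · rw [hne]
    exact h0.eq_of_nhds
  refine eq_zero_of_circleCoeff_eq_zero hu.continuousOn (fun s hs m r hr => ?_) hx hne
  obtain ⟨ρ, hρ, hball⟩ := Metric.eventually_nhds_iff_ball.1 h0
  have hpos : 0 < min r (ρ / 2) := lt_min hr.1 (half_pos hρ)
  set a := min r (ρ / 2) with ha
  have har : a ≤ r := min_le_left _ _
  have haρ : a < ρ := (min_le_right _ _).trans_lt (half_lt_self hρ)
  have hza : ∀ φ, u (x₀ + a • direction φ) = 0 := fun φ =>
    hball _ (polar_mem_ball x₀ hpos.le haρ φ)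
  have hda : ∀ φ, wirtinger s u (x₀ + a • direction φ) = 0 := fun φ => by
    have : u =ᶠ[𝓝 (x₀ + a • direction φ)] fun _ => (0 : ℂ) := by
      filter_upwards [isOpen_ball.mem_nhds (polar_mem_ball x₀ hpos.le haρ φ)] with y hy
        using hball y hy
    rw [wirtinger, this.fderiv_eq]
    simp
  set c := circleCoeff s m x₀ u
  set P := circleCoeff s (m + 1) x₀ (wirtinger s u)
  have hc : ∀ t ∈ Icc a r, HasDerivAt c (P t + m * c t / t) t := fun t ht =>
    hasDerivAt_circleCoeff_solution hs m hu (hpos.trans_le ht.1) (ht.2.trans_lt hr.2)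
  have hP : ∀ t ∈ Icc a r, HasDerivAt P (-(k ^ 2 * c t) - (m + 1) * P t / t) t := fun t ht =>
    hasDerivAt_circleCoeff_wirtinger hs m hu hΔ (hpos.trans_le ht.1) (ht.2.trans_lt hr.2)
  have hca : c a = 0 := by simp [c, circleCoeff, hza]
  have hPa : P a = 0 := by simp [P, circleCoeff, hda]
  have hpair : ∀ t ∈ Icc a r, HasDerivAt (fun y => (c y, P y))
      (P t + m * c t / t, -(k ^ 2 * c t) - (m + 1) * P t / t) t := fun t ht =>
    (hc t ht).prodMk (hP t ht)
  -- `K` bounds the system in the maximum norm, using `1/t ≤ 1/a`.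
  have hres := eq_zero_of_abs_deriv_le_mul_abs_self_of_eq_zero_right
    (f := fun y => (c y, P y)) (K := 1 + k ^ 2 + (m + 1) / a) (a := a) (b := r)
    (fun t ht => (hpair t ht).continuousAt.continuousWithinAt)
    (fun t ht => (hpair t (Ico_subset_Icc_self ht)).hasDerivWithinAt) (by simp [hca, hPa]) ?_ r
    ⟨har, le_rfl⟩
  · exact congrArg Prod.fst hres
  intro t ht
  have ht0 : 0 < t := hpos.trans_le ht.1
  set N := ‖(c t, P t)‖ with hN
  have hN0 : 0 ≤ N := norm_nonneg _
  have hcN : ‖c t‖ ≤ N := norm_fst_le (c t, P t)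
  have hPN : ‖P t‖ ≤ N := norm_snd_le (c t, P t)
  have hta : (m + 1 : ℝ) / t ≤ (m + 1) / a := by
    have := ht.1
    gcongr
  have h1 : ‖(m : ℂ) * c t / t‖ ≤ (m + 1) / a * N := by
    rw [norm_div, norm_mul, Complex.norm_natCast, Complex.norm_real, Real.norm_eq_abs,
      abs_of_pos ht0, mul_div_right_comm]
    have : (m : ℝ) / t ≤ (m + 1) / a := le_trans (by gcongr; linarith) hta
    gcongr
  have h2 : ‖((m : ℂ) + 1) * P t / t‖ ≤ (m + 1) / a * N := by
    rw [norm_div, norm_mul, Complex.norm_real, Real.norm_eq_abs,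
      abs_of_pos ht0, mul_div_right_comm]
    have h3 : ‖((m : ℂ) + 1)‖ = m + 1 := by
      rw [← Nat.cast_succ, Complex.norm_natCast, Nat.cast_succ]
    rw [h3]
    gcongr
  have h4 : ‖(k : ℂ) ^ 2 * c t‖ ≤ k ^ 2 * N := by
    rw [norm_mul, norm_pow, Complex.norm_real, Real.norm_eq_abs, sq_abs]
    gcongr
  rw [Prod.norm_mk]
  refine max_le ?_ ?_
  · refine (norm_add_le _ _).trans ?_
    have : 0 ≤ k ^ 2 * N := by positivity
    linarith
  · refine (norm_sub_le _ _).trans ?_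
    rw [norm_neg]
    linarith

/-- The points near which `u` vanishes form an open set that is also relatively closed: a ball about
a nearby such point, of half the available radius, stays in `Ω` and contains the limit point. -/
theorem eqOn_zero_of_eventuallyEq_zero {Ω : Set Plane} (hΩ : IsOpen Ω) (hconn : IsPreconnected Ω)
    {k : ℝ} {u : Plane → ℂ} (hu : SolvesHelmholtz Ω k u) {y : Plane} (hy : y ∈ Ω)
    (h0 : u =ᶠ[𝓝 y] 0) {x : Plane} (hx : x ∈ Ω) : u x = 0 := by
  have hopen : IsOpen {z : Plane | u =ᶠ[𝓝 z] 0} := isOpen_setOfPred_eventually_nhds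
  refine (hconn.subset_of_closure_inter_subset hopen ⟨y, hy, h0⟩ ?_ hx).eq_of_nhds
  rintro z ⟨hz, hzΩ⟩
  obtain ⟨ρ, hρ, hball⟩ := Metric.isOpen_iff.1 hΩ z hzΩ
  obtain ⟨x₀, hx₀, hd⟩ := Metric.mem_closure_iff.1 hz (ρ / 2) (half_pos hρ)
  have hsub : ball x₀ (ρ / 2) ⊆ Ω := fun w hw => hball (by
    rw [mem_ball] at hw ⊢
    linarith [dist_triangle w x₀ z, dist_comm z x₀])
  filter_upwards [isOpen_ball.mem_nhds (show z ∈ ball x₀ (ρ / 2) from hd)] with w hw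
  exact eq_zero_on_ball (hu.1.mono hsub) (fun v hv => hu.2 v (hsub hv)) hx₀ hw

end RobinLines

/-! ### The Robin condition at leading order, and the two-line system. -/

namespace RobinLines

open MeasureTheory Metric Set Filter Topology

theorem summable_int_weight (a b : ℝ) :
    Summable fun n : ℤ => (a + b * n.natAbs) * (1 / 2 : ℝ) ^ n.natAbs := by
  have h : Summable fun n : ℕ => (a + b * n) * (1 / 2 : ℝ) ^ n := by
    have h1 : Summable fun n : ℕ => (1 / 2 : ℝ) ^ n :=
      summable_geometric_of_lt_one (by norm_num) (by norm_num)
    have h2 : Summable fun n : ℕ => (n : ℝ) ^ 1 * (1 / 2 : ℝ) ^ n :=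
      summable_pow_mul_geometric_of_norm_lt_one 1 (by norm_num)
    refine ((h1.mul_left a).add (h2.mul_left b)).congr fun n => ?_
    ring
  exact Summable.of_nat_of_neg (by simpa using h) (by simpa using h)

/-- Here `q R` stands for the radius. Modes of order below `N` vanish; at order `N` the `α` term has
one extra factor `q`; and an order `N + 1 + j` contributes `q^(N+1+j) ≤ q^(N+1) 2^(-j)`, which
leaves a convergent series independent of `q`. -/
theorem norm_robin_leading_le {c : ℤ → ℂ} {α β θ M q R : ℝ} {N : ℕ} (hN : 0 < N) (hM : 0 ≤ M)
    (hq : 0 ≤ q) (hq2 : q ≤ 1 / 2) (hR : 0 ≤ R)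
    (hzero : ∀ n : ℤ, n.natAbs < N → c n = 0) (hc : ∀ n : ℤ, ‖c n‖ ≤ M * q ^ n.natAbs)
    (hsum : HasSum (fun n : ℤ => (α * (q * R) + β * (n * Complex.I)) * c n
      * Complex.exp (n * Complex.I * θ)) 0) :
    |β| * N * ‖c N * Complex.exp (N * Complex.I * θ) - c (-N) * Complex.exp (-(N * Complex.I * θ))‖
      ≤ (M * 2 ^ (N + 1) * ∑' n : ℤ, (|α| * R + |β| * n.natAbs) * (1 / 2 : ℝ) ^ n.natAbs)
        * q ^ (N + 1) := by
  -- `D` retains the `β` part of the modes `± N` only; everything else in the series is error.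
  set D : ℤ → ℂ := fun n => if n ∈ ({(N : ℤ), -(N : ℤ)} : Finset ℤ) then
    β * (n * Complex.I) * c n * Complex.exp (n * Complex.I * θ) else 0 with hD
  have hne : (N : ℤ) ≠ -N := by omega
  have hDsum : HasSum D (β * N * Complex.I * (c N * Complex.exp (N * Complex.I * θ)
      - c (-N) * Complex.exp (-(N * Complex.I * θ)))) := by
    have h : HasSum D (∑ n ∈ {(N : ℤ), -(N : ℤ)}, D n) :=
      hasSum_sum_of_ne_finset_zero fun n hn => if_neg hn
    convert! h using 1
    rw [Finset.sum_pair hne, hD]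
    simp only [Finset.mem_insert, Finset.mem_singleton, true_or, or_true, if_true]
    push_cast
    rw [neg_mul, neg_mul]
    ring
  have hdiff := hDsum.sub hsum
  rw [sub_zero] at hdiff
  have hbound : ∀ n : ℤ, ‖D n - (α * (q * R) + β * (n * Complex.I)) * c n
      * Complex.exp (n * Complex.I * θ)‖ ≤ (M * 2 ^ (N + 1) * q ^ (N + 1)) *
        ((|α| * R + |β| * n.natAbs) * (1 / 2 : ℝ) ^ n.natAbs) := by
    intro n
    have hexp : ‖Complex.exp (n * Complex.I * θ)‖ = 1 := by
      rw [Complex.norm_exp]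
      simp
    have hrhs : 0 ≤ (M * 2 ^ (N + 1) * q ^ (N + 1)) *
        ((|α| * R + |β| * n.natAbs) * (1 / 2 : ℝ) ^ n.natAbs) := by positivity
    have hnat : ‖(n : ℂ)‖ = n.natAbs := by
      rw [Complex.norm_intCast, Nat.cast_natAbs, Int.cast_abs]
    rcases lt_trichotomy n.natAbs N with hlt | heq | hgt
    · have h1 : D n = 0 ∨ D n = β * (n * Complex.I) * c n * Complex.exp (n * Complex.I * θ) := by
        rw [hD]
        dsimp only
        split_ifs
        · exact Or.inr rfl
        · exact Or.inl rfl
      have h2 : D n = 0 := by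
        rcases h1 with h1 | h1
        · exact h1
        · rw [h1, hzero n hlt]
          simp
      rw [h2, hzero n hlt]
      simpa using hrhs
    · have h1 : D n = β * (n * Complex.I) * c n * Complex.exp (n * Complex.I * θ) :=
        if_pos (by
          simp only [Finset.mem_insert, Finset.mem_singleton]
          omega)
      have h2 : D n - (α * (q * R) + β * (n * Complex.I)) * c n * Complex.exp (n * Complex.I * θ)
          = -(α * (q * R) * c n * Complex.exp (n * Complex.I * θ)) := by
        rw [h1]
        ring
      rw [h2, norm_neg, norm_mul, hexp, mul_one, norm_mul, norm_mul, norm_mul, Complex.norm_real,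
        Complex.norm_real, Complex.norm_real, Real.norm_eq_abs, Real.norm_eq_abs, Real.norm_eq_abs,
        abs_of_nonneg hq, abs_of_nonneg hR]
      calc |α| * (q * R) * ‖c n‖ ≤ |α| * (q * R) * (M * q ^ n.natAbs) := by
            gcongr
            exact hc n
        _ = M * q ^ (N + 1) * (|α| * R) := by
            rw [heq]
            ring
        _ ≤ M * q ^ (N + 1) * (2 * (|α| * R + |β| * n.natAbs)) := by
            refine mul_le_mul_of_nonneg_left ?_ (by positivity)
            have : 0 ≤ |α| * R := by positivity
            have : 0 ≤ |β| * n.natAbs := by positivity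
            linarith
        _ = _ := by
            rw [heq, one_div, inv_pow]
            field_simp
            ring
    · have h1 : D n = 0 := if_neg (by
          simp only [Finset.mem_insert, Finset.mem_singleton]
          omega)
      rw [h1, zero_sub, norm_neg, norm_mul, hexp, mul_one, norm_mul]
      have h2 : ‖(α : ℂ) * (q * R) + β * (n * Complex.I)‖ ≤ |α| * R + |β| * n.natAbs := by
        refine (norm_add_le _ _).trans ?_
        simp only [norm_mul, Complex.norm_real, Complex.norm_I, mul_one, Real.norm_eq_abs, hnat,
          abs_of_nonneg hq, abs_of_nonneg hR]
        gcongr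
        exact mul_le_of_le_one_left hR (by linarith)
      obtain ⟨j, hj⟩ : ∃ j, n.natAbs = N + 1 + j := ⟨n.natAbs - (N + 1), by omega⟩
      have h3 : q ^ n.natAbs ≤ 2 ^ (N + 1) * q ^ (N + 1) * (1 / 2 : ℝ) ^ n.natAbs := by
        rw [hj, pow_add q, pow_add (1 / 2 : ℝ) (N + 1) j, one_div, inv_pow, inv_pow]
        have h4 : q ^ j ≤ (2 ^ j)⁻¹ := by
          rw [← inv_pow, ← one_div]
          exact pow_le_pow_left₀ hq hq2 j
        have h5 : (2 : ℝ) ^ (N + 1) * q ^ (N + 1) * (((2 : ℝ) ^ (N + 1))⁻¹ * (2 ^ j)⁻¹)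
            = q ^ (N + 1) * (2 ^ j)⁻¹ := by field_simp
        rw [h5]
        gcongr
      calc _ ≤ (|α| * R + |β| * n.natAbs) * (M * q ^ n.natAbs) := by
            gcongr
            exact hc n
        _ ≤ (|α| * R + |β| * n.natAbs)
            * (M * (2 ^ (N + 1) * q ^ (N + 1) * (1 / 2 : ℝ) ^ n.natAbs)) := by gcongr
        _ = _ := by ring
  have h := tsum_of_norm_bounded ((summable_int_weight (|α| * R) |β|).hasSum.mul_left
    (M * 2 ^ (N + 1) * q ^ (N + 1))) hbound
  rw [hdiff.tsum_eq] at h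
  rw [norm_mul, norm_mul, norm_mul, Complex.norm_real, Complex.norm_I, Complex.norm_natCast,
    Real.norm_eq_abs, mul_one] at h
  refine h.trans_eq ?_
  ring

/-- Cramer's rule for the two Robin conditions on the Fourier modes `± N`. -/
theorem two_lines_cramer (x y : ℂ) (N : ℕ) (θ₁ θ₂ : ℝ) :
    2 * Complex.I * Real.sin (N * (θ₁ - θ₂)) * x =
      Complex.exp (-(N * Complex.I * θ₂)) * (x * Complex.exp (N * Complex.I * θ₁)
        - y * Complex.exp (-(N * Complex.I * θ₁)))
      - Complex.exp (-(N * Complex.I * θ₁)) * (x * Complex.exp (N * Complex.I * θ₂)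
        - y * Complex.exp (-(N * Complex.I * θ₂))) ∧
    2 * Complex.I * Real.sin (N * (θ₁ - θ₂)) * y =
      Complex.exp (N * Complex.I * θ₂) * (x * Complex.exp (N * Complex.I * θ₁)
        - y * Complex.exp (-(N * Complex.I * θ₁)))
      - Complex.exp (N * Complex.I * θ₁) * (x * Complex.exp (N * Complex.I * θ₂)
        - y * Complex.exp (-(N * Complex.I * θ₂))) := by
  have h : 2 * Complex.I * Real.sin (N * (θ₁ - θ₂))
      = Complex.exp (N * Complex.I * θ₁) * Complex.exp (-(N * Complex.I * θ₂))
      - Complex.exp (-(N * Complex.I * θ₁)) * Complex.exp (N * Complex.I * θ₂) := by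
    rw [← Complex.exp_add, ← Complex.exp_add]
    push_cast
    rw [Complex.sin]
    ring_nf
    rw [Complex.I_sq]
    ring_nf
  have h1 : Complex.exp (N * Complex.I * θ₁) * Complex.exp (-(N * Complex.I * θ₁)) = 1 := by
    rw [← Complex.exp_add, add_neg_cancel, Complex.exp_zero]
  have h2 : Complex.exp (N * Complex.I * θ₂) * Complex.exp (-(N * Complex.I * θ₂)) = 1 := by
    rw [← Complex.exp_add, add_neg_cancel, Complex.exp_zero]
  rw [h]
  constructor <;> ring

theorem norm_le_of_two_lines (x y : ℂ) {N : ℕ} {θ₁ θ₂ B : ℝ}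
    (h₁ : ‖x * Complex.exp (N * Complex.I * θ₁) - y * Complex.exp (-(N * Complex.I * θ₁))‖ ≤ B)
    (h₂ : ‖x * Complex.exp (N * Complex.I * θ₂) - y * Complex.exp (-(N * Complex.I * θ₂))‖ ≤ B) :
    |Real.sin (N * (θ₁ - θ₂))| * ‖x‖ ≤ B ∧ |Real.sin (N * (θ₁ - θ₂))| * ‖y‖ ≤ B := by
  have hexp : ∀ t : ℝ, ‖Complex.exp (N * Complex.I * t)‖ = 1 := fun t => by
    rw [Complex.norm_exp]
    simp
  have hexp' : ∀ t : ℝ, ‖Complex.exp (-(N * Complex.I * t))‖ = 1 := fun t => by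
    rw [Complex.norm_exp]
    simp
  obtain ⟨hx, hy⟩ := two_lines_cramer x y N θ₁ θ₂
  have hn : ∀ z : ℂ, ‖2 * Complex.I * Real.sin (N * (θ₁ - θ₂)) * z‖
      = 2 * (|Real.sin (N * (θ₁ - θ₂))| * ‖z‖) := fun z => by
    rw [norm_mul, norm_mul, norm_mul, Complex.norm_I, Complex.norm_real, Real.norm_eq_abs]
    norm_num
    ring
  constructor
  · have h := congrArg norm hx
    rw [hn] at h
    have h' := (norm_sub_le (Complex.exp (-(N * Complex.I * θ₂)) * (x * Complex.exp (N * Complex.I * θ₁)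
        - y * Complex.exp (-(N * Complex.I * θ₁))))
      (Complex.exp (-(N * Complex.I * θ₁)) * (x * Complex.exp (N * Complex.I * θ₂)
        - y * Complex.exp (-(N * Complex.I * θ₂)))))
    rw [norm_mul, norm_mul, hexp', hexp', one_mul, one_mul] at h'
    linarith
  · have h := congrArg norm hy
    rw [hn] at h
    have h' := (norm_sub_le (Complex.exp (N * Complex.I * θ₂) * (x * Complex.exp (N * Complex.I * θ₁)
        - y * Complex.exp (-(N * Complex.I * θ₁))))
      (Complex.exp (N * Complex.I * θ₁) * (x * Complex.exp (N * Complex.I * θ₂)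
        - y * Complex.exp (-(N * Complex.I * θ₂)))))
    rw [norm_mul, norm_mul, hexp, hexp, one_mul, one_mul] at h'
    linarith

theorem sin_natCast_mul_ne_zero {t : ℝ} (ht : ∀ q : ℚ, t ≠ (q : ℝ) * Real.pi) {N : ℕ}
    (hN : 0 < N) : Real.sin (N * t) ≠ 0 := by
  intro h
  obtain ⟨p, hp⟩ := Real.sin_eq_zero_iff.1 h
  have hN' : (N : ℝ) ≠ 0 := by positivity
  refine ht ((p : ℚ) / N) ?_
  push_cast
  field_simp
  linarith

end RobinLines

/-! ### Local uniqueness at the origin. -/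

namespace RobinLines

open MeasureTheory Metric Set Filter Topology

theorem norm_e₁ : ‖e₁‖ = 1 := (EuclideanSpace.basisFun (Fin 2) ℝ).norm_eq_one 0

theorem norm_e₂ : ‖e₂‖ = 1 := (EuclideanSpace.basisFun (Fin 2) ℝ).norm_eq_one 1

theorem norm_eq_one_of_eq_or {s : ℂ} (hs : s = Complex.I ∨ s = -Complex.I) : ‖s‖ = 1 := by
  rcases hs with rfl | rfl <;> simp

theorem norm_wirtinger_le {s : ℂ} (hs : s = Complex.I ∨ s = -Complex.I) (u : Plane → ℂ)
    (x : Plane) : ‖wirtinger s u x‖ ≤ 2 * ‖fderiv ℝ u x‖ := by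
  refine (norm_sub_le _ _).trans ?_
  rw [norm_mul, norm_eq_one_of_eq_or hs, one_mul]
  have h1 := (fderiv ℝ u x).le_opNorm e₁
  have h2 := (fderiv ℝ u x).le_opNorm e₂
  rw [norm_e₁, mul_one] at h1
  rw [norm_e₂, mul_one] at h2
  linarith

theorem smul_direction_mem_line (θ r : ℝ) : r • direction θ ∈ line θ := ⟨r, rfl⟩

section

variable {R₀ R k : ℝ} {u : Plane → ℂ}

theorem exists_circleCoeff_bound (hu : ContDiffOn ℝ 2 u (ball 0 R₀)) (hR : R < R₀) :
    ∃ M : ℝ, 0 ≤ M ∧ ∀ s : ℂ, s = Complex.I ∨ s = -Complex.I → ∀ n : ℕ, ∀ r ∈ Ioc 0 R,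
      ‖circleCoeff s n 0 u r‖ ≤ M ∧ ‖circleCoeff s n 0 (wirtinger s u) r‖ ≤ M := by
  have hu1 : ContDiffOn ℝ 1 u (ball 0 R₀) := hu.of_le one_le_two
  obtain ⟨M₁, hM₁⟩ := (isCompact_closedBall (0 : Plane) R).exists_bound_of_continuousOn
    (hu.continuousOn.mono (closedBall_subset_ball hR))
  obtain ⟨M₂, hM₂⟩ := (isCompact_closedBall (0 : Plane) R).exists_bound_of_continuousOn
    ((continuousOn_fderiv_ball hu1).mono (closedBall_subset_ball hR))
  refine ⟨max 0 (max (M₁ * (2 * Real.pi)) (2 * M₂ * (2 * Real.pi))), le_max_left _ _,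
    fun s hs n r hr => ?_⟩
  have hmem : ∀ φ, (0 : Plane) + r • direction φ ∈ closedBall (0 : Plane) R := fun φ =>
    closedBall_subset_closedBall hr.2 (polar_mem_closedBall 0 hr.1.le φ)
  constructor
  · exact ((norm_circleCoeff_le hs n 0 fun φ => hM₁ _ (hmem φ)).trans (le_max_left _ _)).trans
      (le_max_right _ _)
  · refine ((norm_circleCoeff_le hs n 0 fun φ => ?_).trans (le_max_right _ _)).trans
      (le_max_right _ _)
    exact (norm_wirtinger_le hs u _).trans
      (mul_le_mul_of_nonneg_left (hM₂ _ (hmem φ)) zero_le_two)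

/-- The condition multiplied by `2π r`: the factor `r` turns the normal derivative into the angular
one, whose coefficients are `i n c_n`. The geometric bound makes both Fourier series summable. -/
theorem hasSum_robin (hu : ContDiffOn ℝ 2 u (ball 0 R₀)) {α β θ r : ℝ} (hr : 0 < r)
    (hrR : r < R₀) (hrobin : α • u (r • direction θ) + β • normalDeriv θ u (r • direction θ) = 0)
    {C q : ℝ} (hq : 0 ≤ q) (hq2 : q ≤ 1 / 2)
    (hc : ∀ n : ℤ, ‖circleCoeff (signI n) n.natAbs 0 u r‖ ≤ C * q ^ n.natAbs) :
    HasSum (fun n : ℤ => (α * r + β * (n * Complex.I)) * circleCoeff (signI n) n.natAbs 0 u r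
      * Complex.exp (n * Complex.I * θ)) 0 := by
  have hu1 : ContDiffOn ℝ 1 u (ball 0 R₀) := hu.of_le one_le_two
  have hC : 0 ≤ C := by
    have h := (norm_nonneg _).trans (hc 0)
    simpa using h
  have hle : ∀ n : ℤ, C * q ^ n.natAbs ≤ C * (1 / 2) ^ n.natAbs := fun n =>
    mul_le_mul_of_nonneg_left (pow_le_pow_left₀ hq hq2 _) hC
  have hs1 : Summable fun n : ℤ => circleCoeff (signI n) n.natAbs 0 u r := by
    refine Summable.of_norm_bounded (summable_int_weight C 0) fun n => ?_
    rw [zero_mul, add_zero]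
    exact (hc n).trans (hle n)
  have hs2 : Summable fun n : ℤ => (n * Complex.I) * circleCoeff (signI n) n.natAbs 0 u r := by
    refine Summable.of_norm_bounded (summable_int_weight 0 C) fun n => ?_
    rw [norm_mul, norm_mul, Complex.norm_I, mul_one, Complex.norm_intCast, ← Int.cast_abs,
      ← Nat.cast_natAbs, zero_add, mul_comm C, mul_assoc]
    exact mul_le_mul_of_nonneg_left ((hc n).trans (hle n)) (Nat.cast_nonneg _)
  have hnor : ∀ n : ℤ, (∫ φ in (0 : ℝ)..2 * Real.pi,
      (r * fderiv ℝ u ((0 : Plane) + r • direction φ) (normal φ)) * character (signI n) n.natAbs φ)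
      = (n * Complex.I) * circleCoeff (signI n) n.natAbs 0 u r := by
    intro n
    have h := integral_fderiv_normal (signI_eq_or n) n.natAbs hu1 hr.le hrR
    rw [signI_mul_natAbs, neg_mul, neg_neg] at h
    rw [← h, ← intervalIntegral.integral_const_mul]
    exact intervalIntegral.integral_congr fun φ _ => mul_assoc _ _ _
  have h1 := hasSum_fourierSeries (continuous_comp_polar hu.continuousOn hr.le hrR)
    (fun φ => by rw [direction_add_two_pi]) hs1 θ
  have h2 := hasSum_fourierSeries
    (g := fun φ => r * fderiv ℝ u ((0 : Plane) + r • direction φ) (normal φ))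
    (continuous_const.mul (continuous_fderiv_normal hu1 hr.le hrR))
    (fun φ => by rw [direction_add_two_pi, normal_add_two_pi]) (by simpa only [hnor] using hs2) θ
  have h3 := ((h1.mul_left (α * r : ℂ)).add (h2.mul_left (β : ℂ))).mul_left (2 * Real.pi : ℂ)
  have hπ : (Real.pi : ℂ) ≠ 0 := by exact_mod_cast Real.pi_ne_zero
  convert! h3 using 1
  · ext n
    rw [hnor, ← circleCoeff]
    field_simp
  · rw [normalDeriv, Complex.real_smul, Complex.real_smul] at hrobin
    rw [zero_add]
    linear_combination (-2 * Real.pi * r : ℂ) * hrobin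

/-- Strong induction on the order of the modes: on each line the condition gains one power of `r`
over the generic size `r^N`, and the nonzero determinant transfers this gain to the modes `± N`. -/
theorem eventuallyEq_zero_of_robin {α₁ α₂ β₁ β₂ θ₁ θ₂ : ℝ} (hR₀ : 0 < R₀)
    (hu : IsSolution (ball (0 : Plane) R₀) k α₁ β₁ θ₁ α₂ β₂ θ₂ u) (hβ₁ : β₁ ≠ 0) (hβ₂ : β₂ ≠ 0)
    (hθ : ∀ q : ℚ, θ₁ - θ₂ ≠ (q : ℝ) * Real.pi) (h0 : u 0 = 0) : u =ᶠ[𝓝 0] 0 := by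
  obtain ⟨⟨hC, hΔ⟩, hr₁, hr₂⟩ := hu
  obtain ⟨R, hR, hRR₀, hkR⟩ : ∃ R, 0 < R ∧ R < R₀ ∧ k ^ 2 * R ^ 2 ≤ 1 / 2 := by
    have h1 : Tendsto (fun R : ℝ => k ^ 2 * R ^ 2) (𝓝[>] 0) (𝓝 0) := by
      have h : Continuous fun R : ℝ => k ^ 2 * R ^ 2 := by fun_prop
      simpa using (h.tendsto 0).mono_left (nhdsWithin_le_nhds (s := Ioi 0))
    obtain ⟨R, h2, h3⟩ := ((h1.eventually_le_const (by norm_num : (0 : ℝ) < 1 / 2)).and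
      (Ioo_mem_nhdsGT hR₀)).exists
    exact ⟨R, h3.1, h3.2, h2⟩
  obtain ⟨M, hM0, hM⟩ := exists_circleCoeff_bound hC hRR₀
  have hode : ∀ s : ℂ, s = Complex.I ∨ s = -Complex.I → ∀ m : ℕ, ∀ r ∈ Ioc 0 R,
      HasDerivAt (circleCoeff s m 0 u) (circleCoeff s (m + 1) 0 (wirtinger s u) r
        + m * circleCoeff s m 0 u r / r) r := fun s hs m r hr =>
    hasDerivAt_circleCoeff_solution hs m hC hr.1 (hr.2.trans_lt hRR₀)
  have hode' : ∀ s : ℂ, s = Complex.I ∨ s = -Complex.I → ∀ m : ℕ, ∀ r ∈ Ioc 0 R,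
      HasDerivAt (circleCoeff s (m + 1) 0 (wirtinger s u)) (-(k ^ 2 * circleCoeff s m 0 u r)
        - (m + 1) * circleCoeff s (m + 1) 0 (wirtinger s u) r / r) r := fun s hs m r hr =>
    hasDerivAt_circleCoeff_wirtinger hs m hC hΔ hr.1 (hr.2.trans_lt hRR₀)
  have hdecay : ∀ s : ℂ, s = Complex.I ∨ s = -Complex.I → ∀ m : ℕ, ∀ r ∈ Ioc 0 R,
      ‖circleCoeff s m 0 u r‖ ≤ 2 * M * (r / R) ^ m := fun s hs m =>
    singular_ode_decay hkR (hode s hs m) (hode' s hs m) (fun r hr => (hM s hs (m + 1) r hr).2)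
      (fun r hr => (hM s hs m r hr).1)
  have hvanish : ∀ s : ℂ, s = Complex.I ∨ s = -Complex.I → ∀ m : ℕ,
      Tendsto (fun r : ℝ => ‖circleCoeff s m 0 u r‖ / r ^ m) (𝓝[>] 0) (𝓝 0) →
      ∀ r ∈ Ioc 0 R, circleCoeff s m 0 u r = 0 := fun s hs m =>
    singular_ode_eq_zero hkR (hode s hs m) (hode' s hs m) (fun r hr => (hM s hs (m + 1) r hr).2)
      (fun r hr => (hM s hs m r hr).1)
  set c : ℤ → ℝ → ℂ := fun n r => circleCoeff (signI n) n.natAbs 0 u r with hc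
  -- The bound of `norm_robin_leading_le` with `q = r / R`; restricting to `r ≤ R / 2` gives `q ≤
  -- 1/2`.
  have hest : ∀ (N : ℕ), 0 < N → (∀ n : ℤ, n.natAbs < N → ∀ r ∈ Ioc 0 R, c n r = 0) →
      ∀ α β θ : ℝ, β ≠ 0 → SatisfiesRobin (ball (0 : Plane) R₀) α β θ u →
      ∃ K : ℝ, ∀ r ∈ Ioc 0 (R / 2), ‖c N r * Complex.exp (N * Complex.I * θ)
        - c (-N) r * Complex.exp (-(N * Complex.I * θ))‖ ≤ K * r ^ (N + 1) := by
    intro N hN hz α β θ hβ hrob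
    obtain ⟨K, hK⟩ : ∃ K : ℝ, K = 2 * M * 2 ^ (N + 1) *
      ∑' n : ℤ, (|α| * R + |β| * n.natAbs) * (1 / 2 : ℝ) ^ n.natAbs := ⟨_, rfl⟩
    refine ⟨K / R ^ (N + 1) / (|β| * N), fun r hr => ?_⟩
    have hrR : r ∈ Ioc 0 R := ⟨hr.1, hr.2.trans (by linarith)⟩
    have hq0 : 0 ≤ r / R := div_nonneg hr.1.le hR.le
    have hq2 : r / R ≤ 1 / 2 := by
      rw [div_le_iff₀ hR]
      linarith [hr.2]
    have hbd : ∀ n : ℤ, ‖c n r‖ ≤ 2 * M * (r / R) ^ n.natAbs := fun n =>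
      hdecay _ (signI_eq_or n) _ r hrR
    have hx : r • direction θ ∈ ball (0 : Plane) R₀ := by
      simpa using polar_mem_ball 0 hr.1.le (hrR.2.trans_lt hRR₀) θ
    have hsum := hasSum_robin hC hr.1 (hrR.2.trans_lt hRR₀)
      (hrob _ ⟨smul_direction_mem_line θ r, hx⟩) hq0 hq2 hbd
    have hRc : (R : ℂ) ≠ 0 := by exact_mod_cast hR.ne'
    have h := norm_robin_leading_le (c := fun n => c n r) (α := α) (q := r / R) (R := R) hN
      (mul_nonneg zero_le_two hM0) hq0 hq2
      hR.le (fun n hn => hz n hn r hrR) hbd (by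
        convert! hsum using 5
        push_cast
        field_simp)
    rw [← hK, div_pow] at h
    have hβN : 0 < |β| * N := mul_pos (abs_pos.2 hβ) (by exact_mod_cast hN)
    rw [div_mul_eq_mul_div, le_div_iff₀ hβN, mul_comm]
    refine h.trans_eq ?_
    ring
  have hall : ∀ N : ℕ, ∀ n : ℤ, n.natAbs = N → ∀ r ∈ Ioc 0 R, c n r = 0 := by
    intro N
    induction N using Nat.strong_induction_on with
    | _ N ih =>
    intro n hn
    refine hvanish _ (signI_eq_or n) _ ?_
    rw [hn]
    rcases Nat.eq_zero_or_pos N with rfl | hN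
    -- Order zero is where `u 0 = 0` enters: by continuity the mean over small circles tends to `0`.
    · simp only [pow_zero, div_one]
      rw [Metric.tendsto_nhds]
      intro ε hε
      have hcont : ContinuousAt u 0 := hC.continuousOn.continuousAt (ball_mem_nhds 0 hR₀)
      have hε' : 0 < ε / (2 * (2 * Real.pi)) := by positivity
      obtain ⟨ρ, hρ, hball⟩ := Metric.continuousAt_iff.1 hcont _ hε'
      filter_upwards [Ioo_mem_nhdsGT hρ] with r hr
      rw [Real.dist_0_eq_abs, abs_of_nonneg (norm_nonneg _)]
      refine (norm_circleCoeff_le (signI_eq_or n) 0 0 (M := ε / (2 * (2 * Real.pi)))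
        fun φ => ?_).trans_lt ?_
      · have h1 := hball (polar_mem_ball 0 hr.1.le hr.2 φ)
        rw [h0, dist_zero_right] at h1
        exact h1.le
      · have : ε / (2 * (2 * Real.pi)) * (2 * Real.pi) = ε / 2 := by
          have := Real.pi_ne_zero
          field_simp
        rw [this]
        exact half_lt_self hε
    · have hz : ∀ n : ℤ, n.natAbs < N → ∀ r ∈ Ioc 0 R, c n r = 0 := fun n hn =>
        ih _ hn n rfl
      obtain ⟨K₁, hK₁⟩ := hest N hN hz α₁ β₁ θ₁ hβ₁ hr₁
      obtain ⟨K₂, hK₂⟩ := hest N hN hz α₂ β₂ θ₂ hβ₂ hr₂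
      have hsin := abs_pos.2 (sin_natCast_mul_ne_zero hθ hN)
      set σ := |Real.sin (N * (θ₁ - θ₂))| with hσ
      have hb : ∀ r ∈ Ioc 0 (R / 2), ‖c n r‖ / r ^ N ≤ max K₁ K₂ / σ * r := by
        intro r hr
        have hrp : 0 < r ^ N := pow_pos hr.1 N
        have hrp1 : 0 ≤ r ^ (N + 1) := (pow_pos hr.1 _).le
        obtain ⟨hx, hy⟩ := norm_le_of_two_lines (c N r) (c (-N) r)
          ((hK₁ r hr).trans (mul_le_mul_of_nonneg_right (le_max_left K₁ K₂) hrp1))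
          ((hK₂ r hr).trans (mul_le_mul_of_nonneg_right (le_max_right K₁ K₂) hrp1))
        have hcn : σ * ‖c n r‖ ≤ max K₁ K₂ * r ^ (N + 1) := by
          rcases Int.natAbs_eq n with h | h
          · rw [h, hn]
            exact hx
          · rw [h, hn]
            exact hy
        rw [div_le_iff₀ hrp, div_mul_eq_mul_div, div_mul_eq_mul_div, le_div_iff₀ hsin, mul_comm]
        refine hcn.trans_eq ?_
        ring
      refine tendsto_of_tendsto_of_tendsto_of_le_of_le' tendsto_const_nhds
        (h := fun r => max K₁ K₂ / σ * r) ?_ ?_ ?_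
      · have h : Continuous fun r : ℝ => max K₁ K₂ / σ * r := by fun_prop
        simpa using (h.tendsto 0).mono_left (nhdsWithin_le_nhds (s := Ioi 0))
      · filter_upwards [self_mem_nhdsWithin] with r hr
        exact div_nonneg (norm_nonneg _) (pow_pos hr N).le
      · filter_upwards [Ioo_mem_nhdsGT (half_pos hR)] with r hr
        have h := hb r ⟨hr.1, hr.2.le⟩
        simp only [hc, hn] at h
        exact h
  have hcoeff : ∀ s : ℂ, s = Complex.I ∨ s = -Complex.I → ∀ n : ℕ, ∀ r ∈ Ioo 0 R,
      circleCoeff s n 0 u r = 0 := by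
    intro s hs n r hr
    rcases hs with rfl | rfl
    -- `signI 0` is `-I`, so order zero with `s = I` is separate; both characters are then the
    -- constant `1`.
    · rcases Nat.eq_zero_or_pos n with rfl | hn
      · have h := hall 0 0 rfl r ⟨hr.1, hr.2.le⟩
        simpa [hc, circleCoeff, character] using h
      · have h := hall n (-n) (by simp) r ⟨hr.1, hr.2.le⟩
        have hneg : ¬ (0 : ℤ) ≤ -n := by omega
        simp only [hc, signI, if_neg hneg, Int.natAbs_neg, Int.natAbs_natCast] at h
        exact h
    · have h := hall n n (by simp) r ⟨hr.1, hr.2.le⟩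
      simp only [hc, signI, if_pos (Int.natCast_nonneg n), Int.natAbs_natCast] at h
      exact h
  filter_upwards [ball_mem_nhds (0 : Plane) hR] with x hx
  by_cases hne : x = 0
  · rw [hne, h0]
    rfl
  · exact eq_zero_of_circleCoeff_eq_zero (hC.continuousOn.mono (ball_subset_ball hRR₀.le))
      hcoeff hx hne

end

end RobinLines

/-! ### Entire power series in `z` and `z̄`. -/

namespace RobinLines

open Metric Set Filter Topology

/-- The complex coordinate `z` on the plane. -/
def zCoord : Plane →L[ℝ] ℂ :=
  (EuclideanSpace.proj (0 : Fin 2) : Plane →L[ℝ] ℝ).smulRight (1 : ℂ)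
    + (EuclideanSpace.proj (1 : Fin 2) : Plane →L[ℝ] ℝ).smulRight Complex.I

/-- The conjugate `z̄` of the complex coordinate on the plane. -/
def zbarCoord : Plane →L[ℝ] ℂ :=
  (EuclideanSpace.proj (0 : Fin 2) : Plane →L[ℝ] ℝ).smulRight (1 : ℂ)
    - (EuclideanSpace.proj (1 : Fin 2) : Plane →L[ℝ] ℝ).smulRight Complex.I

theorem zCoord_apply (x : Plane) : zCoord x = x 0 + x 1 * Complex.I := by
  simp [zCoord]

theorem zbarCoord_apply (x : Plane) : zbarCoord x = x 0 - x 1 * Complex.I := by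
  simp [zbarCoord]

theorem norm_zCoord_apply (x : Plane) : ‖zCoord x‖ = ‖x‖ := by
  rw [zCoord_apply, Complex.norm_add_mul_I, EuclideanSpace.norm_eq, Fin.sum_univ_two]
  simp

theorem norm_zbarCoord_apply (x : Plane) : ‖zbarCoord x‖ = ‖x‖ := by
  have h : zbarCoord x = x 0 + ((-x 1 : ℝ) : ℂ) * Complex.I := by
    rw [zbarCoord_apply]
    push_cast
    ring
  rw [h, Complex.norm_add_mul_I, EuclideanSpace.norm_eq, Fin.sum_univ_two]
  simp

theorem norm_zCoord_le : ‖zCoord‖ ≤ 1 :=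
  ContinuousLinearMap.opNorm_le_bound _ zero_le_one fun x => by rw [norm_zCoord_apply, one_mul]

theorem norm_zbarCoord_le : ‖zbarCoord‖ ≤ 1 :=
  ContinuousLinearMap.opNorm_le_bound _ zero_le_one fun x => by rw [norm_zbarCoord_apply, one_mul]

theorem zCoord_direction (θ : ℝ) : zCoord (direction θ) = Complex.exp (Complex.I * θ) := by
  rw [zCoord_apply, mul_comm Complex.I (θ : ℂ), Complex.exp_mul_I]
  simp [direction]

theorem zbarCoord_direction (θ : ℝ) : zbarCoord (direction θ) = Complex.exp (-(Complex.I * θ)) := by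
  rw [zbarCoord_apply, mul_comm Complex.I, ← neg_mul, Complex.exp_mul_I, Complex.cos_neg,
    Complex.sin_neg]
  simp [direction]
  ring

theorem zCoord_normal (θ : ℝ) :
    zCoord (normal θ) = Complex.I * Complex.exp (Complex.I * θ) := by
  rw [zCoord_apply, mul_comm Complex.I (θ : ℂ), Complex.exp_mul_I]
  simp only [normal, Matrix.cons_val_zero, Matrix.cons_val_one, PiLp.toLp_apply]
  push_cast
  linear_combination (-Complex.sin θ) * Complex.I_sq

theorem zbarCoord_normal (θ : ℝ) :
    zbarCoord (normal θ) = -(Complex.I * Complex.exp (-(Complex.I * θ))) := by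
  rw [zbarCoord_apply, mul_comm Complex.I (θ : ℂ), ← neg_mul (θ : ℂ), Complex.exp_mul_I,
    Complex.cos_neg, Complex.sin_neg]
  simp only [normal, Matrix.cons_val_zero, Matrix.cons_val_one, PiLp.toLp_apply]
  push_cast
  linear_combination (-Complex.sin θ) * Complex.I_sq

theorem zCoord_e₁ : zCoord e₁ = 1 := by simp [zCoord_apply, e₁]
theorem zCoord_e₂ : zCoord e₂ = Complex.I := by simp [zCoord_apply, e₂]
theorem zbarCoord_e₁ : zbarCoord e₁ = 1 := by simp [zbarCoord_apply, e₁]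
theorem zbarCoord_e₂ : zbarCoord e₂ = -Complex.I := by simp [zbarCoord_apply, e₂]

/-- The coefficients `a` define an entire power series in `(z, z̄)`. -/
def IsEntire (a : ℕ × ℕ → ℂ) : Prop :=
  ∀ R : ℝ, 1 ≤ R → Summable fun p : ℕ × ℕ => ‖a p‖ * R ^ (p.1 + p.2)

/-- The monomial `z^m z̄^n`. -/
def biMonomial (p : ℕ × ℕ) (x : Plane) : ℂ := zCoord x ^ p.1 * zbarCoord x ^ p.2

/-- The sum of the power series in `(z, z̄)` with coefficients `a`. -/
def biSeries (a : ℕ × ℕ → ℂ) (x : Plane) : ℂ := ∑' p, a p * biMonomial p x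

/-- The coefficients of `∂/∂z` of a power series in `(z, z̄)`. -/
def dz (a : ℕ × ℕ → ℂ) (p : ℕ × ℕ) : ℂ := (p.1 + 1) * a (p.1 + 1, p.2)

/-- The coefficients of `∂/∂z̄` of a power series in `(z, z̄)`. -/
def dzbar (a : ℕ × ℕ → ℂ) (p : ℕ × ℕ) : ℂ := (p.2 + 1) * a (p.1, p.2 + 1)

theorem injective_succ_fst : Function.Injective fun p : ℕ × ℕ => (p.1 + 1, p.2) := by
  rintro ⟨m, n⟩ ⟨m', n'⟩ h
  simpa using h

theorem injective_succ_snd : Function.Injective fun p : ℕ × ℕ => (p.1, p.2 + 1) := by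
  rintro ⟨m, n⟩ ⟨m', n'⟩ h
  simpa using h

/-- The factor produced by differentiating a monomial is absorbed by doubling the radius, which is
harmless for an entire series. -/
theorem natCast_mul_pow_le {R : ℝ} (hR : 1 ≤ R) {j i n : ℕ} (hj : j ≤ n) (hi : i ≤ n) :
    j * R ^ i ≤ (2 * R) ^ n := by
  have h1 : (j : ℝ) ≤ 2 ^ n := by
    have h2 : n < 2 ^ n := Nat.lt_two_pow_self
    exact_mod_cast hj.trans h2.le
  have h2 : R ^ i ≤ R ^ n := pow_le_pow_right₀ hR hi
  rw [mul_pow]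
  exact mul_le_mul h1 h2 (by positivity) (by positivity)

theorem IsEntire.dz {a : ℕ × ℕ → ℂ} (ha : IsEntire a) : IsEntire (dz a) := by
  intro R hR
  refine Summable.of_nonneg_of_le (fun p => by positivity) (fun p => ?_)
    ((ha (2 * R) (by linarith)).comp_injective injective_succ_fst)
  have h := natCast_mul_pow_le hR (j := p.1 + 1) (i := p.1 + p.2) (n := p.1 + 1 + p.2)
    (by omega) (by omega)
  have h1 : ‖((p.1 : ℂ) + 1)‖ = ((p.1 + 1 : ℕ) : ℝ) := by
    rw [← Nat.cast_succ, Complex.norm_natCast]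
  simp only [RobinLines.dz, Function.comp_apply]
  rw [norm_mul, h1, mul_comm _ ‖a _‖, mul_assoc]
  exact mul_le_mul_of_nonneg_left h (norm_nonneg _)

theorem IsEntire.dzbar {a : ℕ × ℕ → ℂ} (ha : IsEntire a) : IsEntire (dzbar a) := by
  intro R hR
  refine Summable.of_nonneg_of_le (fun p => by positivity) (fun p => ?_)
    ((ha (2 * R) (by linarith)).comp_injective injective_succ_snd)
  have h := natCast_mul_pow_le hR (j := p.2 + 1) (i := p.1 + p.2) (n := p.1 + (p.2 + 1))
    (by omega) (by omega)
  have h1 : ‖((p.2 : ℂ) + 1)‖ = ((p.2 + 1 : ℕ) : ℝ) := by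
    rw [← Nat.cast_succ, Complex.norm_natCast]
  simp only [RobinLines.dzbar, Function.comp_apply]
  rw [norm_mul, h1, mul_comm _ ‖a _‖, mul_assoc]
  exact mul_le_mul_of_nonneg_left h (norm_nonneg _)

theorem norm_biMonomial (p : ℕ × ℕ) (x : Plane) : ‖biMonomial p x‖ = ‖x‖ ^ (p.1 + p.2) := by
  rw [biMonomial, norm_mul, norm_pow, norm_pow, norm_zCoord_apply, norm_zbarCoord_apply, pow_add]

theorem IsEntire.summable {a : ℕ × ℕ → ℂ} (ha : IsEntire a) (x : Plane) :
    Summable fun p => a p * biMonomial p x := by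
  refine Summable.of_norm_bounded (ha (‖x‖ + 1) (by linarith [norm_nonneg x])) fun p => ?_
  rw [norm_mul, norm_biMonomial]
  gcongr
  linarith

theorem hasFDerivAt_biMonomial (p : ℕ × ℕ) (x : Plane) :
    HasFDerivAt (biMonomial p)
      ((p.1 * zCoord x ^ (p.1 - 1) * zbarCoord x ^ p.2) • zCoord
        + (p.2 * zCoord x ^ p.1 * zbarCoord x ^ (p.2 - 1)) • zbarCoord) x := by
  have h := (zCoord.hasFDerivAt (x := x).pow p.1).mul (zbarCoord.hasFDerivAt (x := x).pow p.2)
  refine h.congr_fderiv ?_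
  ext v
  simp
  ring

theorem tsum_dz (a : ℕ × ℕ → ℂ) (x : Plane) :
    ∑' p : ℕ × ℕ, a p * (p.1 * zCoord x ^ (p.1 - 1) * zbarCoord x ^ p.2) = biSeries (dz a) x := by
  rw [biSeries, ← injective_succ_fst.tsum_eq
    (f := fun p : ℕ × ℕ => a p * (p.1 * zCoord x ^ (p.1 - 1) * zbarCoord x ^ p.2))]
  · refine tsum_congr fun p => ?_
    simp only [dz, biMonomial, Nat.add_sub_cancel]
    push_cast
    ring
  · rintro ⟨m, n⟩ hp
    rcases m with _ | m
    · simp at hp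
    · exact ⟨(m, n), rfl⟩

theorem tsum_dzbar (a : ℕ × ℕ → ℂ) (x : Plane) :
    ∑' p : ℕ × ℕ, a p * (p.2 * zCoord x ^ p.1 * zbarCoord x ^ (p.2 - 1))
      = biSeries (dzbar a) x := by
  rw [biSeries, ← injective_succ_snd.tsum_eq
    (f := fun p : ℕ × ℕ => a p * (p.2 * zCoord x ^ p.1 * zbarCoord x ^ (p.2 - 1)))]
  · refine tsum_congr fun p => ?_
    simp only [dzbar, biMonomial, Nat.add_sub_cancel]
    push_cast
    ring
  · rintro ⟨m, n⟩ hp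
    rcases n with _ | n
    · simp at hp
    · exact ⟨(m, n), rfl⟩

theorem norm_partial_le {R : ℝ} (hR : 1 ≤ R) {x : Plane} (hx : ‖x‖ ≤ R) (m n : ℕ) :
    ‖(m * zCoord x ^ (m - 1) * zbarCoord x ^ n : ℂ)‖ ≤ (2 * R) ^ (m + n) ∧
    ‖(n * zCoord x ^ m * zbarCoord x ^ (n - 1) : ℂ)‖ ≤ (2 * R) ^ (m + n) := by
  simp only [norm_mul, norm_pow, norm_zCoord_apply, norm_zbarCoord_apply, Complex.norm_natCast,
    mul_assoc, ← pow_add]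
  constructor
  · exact (mul_le_mul_of_nonneg_left (pow_le_pow_left₀ (norm_nonneg _) hx _)
      (Nat.cast_nonneg _)).trans (natCast_mul_pow_le hR (by omega) (by omega))
  · exact (mul_le_mul_of_nonneg_left (pow_le_pow_left₀ (norm_nonneg _) hx _)
      (Nat.cast_nonneg _)).trans (natCast_mul_pow_le hR (by omega) (by omega))

/-- Term-by-term differentiation on a ball of radius `R = ‖x‖ + 1`: each of the two partial
derivatives of a monomial is at most `(2R)^(m+n)` there. -/
theorem IsEntire.hasFDerivAt {a : ℕ × ℕ → ℂ} (ha : IsEntire a) (x : Plane) :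
    HasFDerivAt (biSeries a)
      (biSeries (RobinLines.dz a) x • zCoord + biSeries (RobinLines.dzbar a) x • zbarCoord) x := by
  set R := ‖x‖ + 1 with hR
  have hR1 : 1 ≤ R := by linarith [norm_nonneg x]
  have hxR : x ∈ ball (0 : Plane) R := by
    rw [mem_ball_zero_iff]
    linarith
  have hbd := (ha (2 * R) (by linarith)).mul_right 2
  set D : ℕ × ℕ → Plane → Plane →L[ℝ] ℂ := fun p y =>
    a p • ((p.1 * zCoord y ^ (p.1 - 1) * zbarCoord y ^ p.2) • zCoord
        + (p.2 * zCoord y ^ p.1 * zbarCoord y ^ (p.2 - 1)) • zbarCoord) with hD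
  have hDb : ∀ (p : ℕ × ℕ) (y : Plane), y ∈ ball (0 : Plane) R →
      ‖D p y‖ ≤ ‖a p‖ * (2 * R) ^ (p.1 + p.2) * 2 := by
    intro p y hy
    have hy' : ‖y‖ ≤ R := (mem_ball_zero_iff.1 hy).le
    obtain ⟨h1, h2⟩ := norm_partial_le hR1 hy' p.1 p.2
    rw [hD, norm_smul, mul_assoc ‖a p‖]
    refine mul_le_mul_of_nonneg_left ?_ (norm_nonneg (a p))
    refine (norm_add_le _ _).trans ?_
    rw [norm_smul, norm_smul, mul_two]
    exact add_le_add ((mul_le_of_le_one_right (norm_nonneg _) norm_zCoord_le).trans h1)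
      ((mul_le_of_le_one_right (norm_nonneg _) norm_zbarCoord_le).trans h2)
  have h := hasFDerivAt_tsum_of_isPreconnected hbd isOpen_ball
    (convex_ball (0 : Plane) R).isPreconnected (f := fun p y => a p * biMonomial p y) (f' := D)
    (fun p y _ => (hasFDerivAt_biMonomial p y).const_mul (a p))
    hDb
    hxR (ha.summable x) hxR
  refine HasFDerivAt.congr_fderiv h ?_
  have hs1 : Summable fun p : ℕ × ℕ =>
      a p * (p.1 * zCoord x ^ (p.1 - 1) * zbarCoord x ^ p.2) := by
    refine Summable.of_norm_bounded (ha (2 * R) (by linarith)) fun p => ?_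
    rw [norm_mul]
    exact mul_le_mul_of_nonneg_left
      (norm_partial_le hR1 (mem_ball_zero_iff.1 hxR).le p.1 p.2).1 (norm_nonneg _)
  have hs2 : Summable fun p : ℕ × ℕ =>
      a p * (p.2 * zCoord x ^ p.1 * zbarCoord x ^ (p.2 - 1)) := by
    refine Summable.of_norm_bounded (ha (2 * R) (by linarith)) fun p => ?_
    rw [norm_mul]
    exact mul_le_mul_of_nonneg_left
      (norm_partial_le hR1 (mem_ball_zero_iff.1 hxR).le p.1 p.2).2 (norm_nonneg _)
  rw [← tsum_dz, ← tsum_dzbar]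
  have h3 := (hs1.hasSum.smul_const zCoord).add (hs2.hasSum.smul_const zbarCoord)
  rw [← h3.tsum_eq]
  refine tsum_congr fun p => ?_
  rw [hD]
  simp only [smul_add, smul_smul]

theorem IsEntire.fderiv_eq {a : ℕ × ℕ → ℂ} (ha : IsEntire a) :
    fderiv ℝ (biSeries a) = fun x =>
      biSeries (RobinLines.dz a) x • zCoord + biSeries (RobinLines.dzbar a) x • zbarCoord :=
  funext fun x => (ha.hasFDerivAt x).fderiv

theorem IsEntire.contDiff {a : ℕ × ℕ → ℂ} (ha : IsEntire a) (n : ℕ) :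
    ContDiff ℝ n (biSeries a) := by
  induction n generalizing a with
  | zero => exact contDiff_zero.2 (continuous_iff_continuousAt.2 fun x =>
      (ha.hasFDerivAt x).continuousAt)
  | succ n ih =>
    push_cast
    rw [contDiff_succ_iff_fderiv]
    refine ⟨fun x => (ha.hasFDerivAt x).differentiableAt, by simp, ?_⟩
    rw [ha.fderiv_eq]
    exact ((ih ha.dz).smul contDiff_const).add ((ih ha.dzbar).smul contDiff_const)

theorem dz_dzbar_comm (a : ℕ × ℕ → ℂ) : dz (dzbar a) = dzbar (dz a) := by
  ext p
  simp only [dz, dzbar]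
  ring

theorem IsEntire.laplacian_eq {a : ℕ × ℕ → ℂ} (ha : IsEntire a) (x : Plane) :
    Laplacian.laplacian (biSeries a) x
      = 4 * biSeries (RobinLines.dzbar (RobinLines.dz a)) x := by
  have h := HasFDerivAt.add (HasFDerivAt.smul_const (ha.dz.hasFDerivAt x) zCoord)
    (HasFDerivAt.smul_const (ha.dzbar.hasFDerivAt x) zbarCoord)
  have h1 := h.fderiv
  have h2 : fderiv ℝ (fderiv ℝ (biSeries a)) x = _ := (congrArg (fderiv ℝ · x) ha.fderiv_eq).trans h1
  rw [laplacian_eq_fderiv_fderiv, h2, dz_dzbar_comm]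
  simp [zCoord_e₁, zCoord_e₂, zbarCoord_e₁, zbarCoord_e₂]
  linear_combination (biSeries (RobinLines.dz (RobinLines.dz a)) x - 
    2 * biSeries (RobinLines.dzbar (RobinLines.dz a)) x +
    biSeries (RobinLines.dzbar (RobinLines.dzbar a)) x) * Complex.I_sq

theorem IsEntire.solvesHelmholtz {a : ℕ × ℕ → ℂ} (ha : IsEntire a) {k : ℝ}
    (hrec : ∀ m n : ℕ, 4 * ((m + 1) * ((n + 1) * a (m + 1, n + 1))) + k ^ 2 * a (m, n) = 0)
    (Ω : Set Plane) : SolvesHelmholtz Ω k (biSeries a) := by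
  refine ⟨(ha.contDiff 2).contDiffOn, fun x _ => ?_⟩
  rw [ha.laplacian_eq, Complex.real_smul]
  have h := ((ha.dz.dzbar.summable x).hasSum.mul_left 4).add
    ((ha.summable x).hasSum.mul_left ((k ^ 2 : ℝ) : ℂ))
  refine h.unique ?_
  convert! hasSum_zero with p
  have h1 := hrec p.1 p.2
  simp only [RobinLines.dz, RobinLines.dzbar]
  push_cast
  linear_combination biMonomial p x * h1

/-- An absolutely convergent double series may be summed by total degree. -/
theorem tsum_eq_zero_of_antidiagonal {f : ℕ × ℕ → ℂ} (hf : Summable f)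
    (h : ∀ N, ∑ p ∈ Finset.HasAntidiagonal.antidiagonal N, f p = 0) : ∑' p, f p = 0 := by
  have hs := (Finset.HasAntidiagonal.sigmaAntidiagonalEquivProd (A := ℕ)).summable_iff.2 hf
  rw [← (Finset.HasAntidiagonal.sigmaAntidiagonalEquivProd (A := ℕ)).tsum_eq f]
  refine hs.tsum_sigma.trans ?_
  convert! tsum_zero with N
  rw [tsum_fintype, ← h N]
  exact Finset.sum_coe_sort (Finset.HasAntidiagonal.antidiagonal N) f

/-- At `t • direction θ` the monomial `z^m z̄^n` is `t^(m+n)` times a unit complex number, and its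
normal derivative is `i (m - n) t^(m+n-1)` times the same number. The condition can thus be imposed
degree by degree, with `u` in degree `N` paired with degree `N + 1` of the series under `∂ₙ`. -/
theorem IsEntire.satisfiesRobin {a : ℕ × ℕ → ℂ} (ha : IsEntire a) {α β θ : ℝ}
    (hrec : ∀ N : ℕ, α * ∑ p ∈ Finset.HasAntidiagonal.antidiagonal N,
        a p * (Complex.exp (Complex.I * θ) ^ p.1 * Complex.exp (-(Complex.I * θ)) ^ p.2)
      + β * Complex.I * ∑ p ∈ Finset.HasAntidiagonal.antidiagonal (N + 1), (p.1 - p.2) * (a p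
        * (Complex.exp (Complex.I * θ) ^ p.1 * Complex.exp (-(Complex.I * θ)) ^ p.2)) = 0)
    (Ω : Set Plane) : SatisfiesRobin Ω α β θ (biSeries a) := by
  rintro x ⟨⟨t, rfl⟩, -⟩
  set E := Complex.exp (Complex.I * θ) with hE
  set E' := Complex.exp (-(Complex.I * θ)) with hE'
  rw [normalDeriv, ha.fderiv_eq, Complex.real_smul, Complex.real_smul]
  simp only [add_apply, smul_apply, zCoord_normal, zbarCoord_normal, smul_eq_mul]
  rw [← hE, ← hE']
  have hs := ((ha.summable (t • direction θ)).mul_left (α : ℂ)).add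
    (((ha.dz.summable (t • direction θ)).mul_left (β * Complex.I * E)).sub
    ((ha.dzbar.summable (t • direction θ)).mul_left (β * Complex.I * E')))
  have hsum := tsum_eq_zero_of_antidiagonal hs fun N => ?_
  · rw [Summable.tsum_add ((ha.summable _).mul_left _)
      (((ha.dz.summable _).mul_left _).sub ((ha.dzbar.summable _).mul_left _)),
      Summable.tsum_sub ((ha.dz.summable _).mul_left _) ((ha.dzbar.summable _).mul_left _),
      tsum_mul_left, tsum_mul_left, tsum_mul_left] at hsum
    simp only [biSeries]
    linear_combination hsum
  · have hmon : ∀ p ∈ Finset.HasAntidiagonal.antidiagonal N, biMonomial p (t • direction θ)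
        = t ^ N * (E ^ p.1 * E' ^ p.2) := by
      intro p hp
      rw [← Finset.HasAntidiagonal.mem_antidiagonal.1 hp, biMonomial, map_smul, map_smul, zCoord_direction,
        zbarCoord_direction, Complex.real_smul, Complex.real_smul]
      ring
    have h1 := hrec N
    have h2 : ∑ p ∈ Finset.HasAntidiagonal.antidiagonal (N + 1), ((p.1 : ℂ) - p.2) * (a p * (E ^ p.1 * E' ^ p.2))
        = ∑ p ∈ Finset.HasAntidiagonal.antidiagonal N, E * RobinLines.dz a p * (E ^ p.1 * E' ^ p.2)
        - ∑ p ∈ Finset.HasAntidiagonal.antidiagonal N, E' * RobinLines.dzbar a p * (E ^ p.1 * E' ^ p.2) := by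
      simp only [sub_mul]
      rw [Finset.sum_sub_distrib]
      congr 1
      · rw [Finset.Nat.sum_antidiagonal_succ]
        simp only [Nat.cast_zero, zero_mul, zero_add]
        refine Finset.sum_congr rfl fun p _ => ?_
        simp only [RobinLines.dz]
        push_cast
        ring
      · rw [Finset.Nat.sum_antidiagonal_succ']
        simp only [Nat.cast_zero, zero_mul, zero_add]
        refine Finset.sum_congr rfl fun p _ => ?_
        simp only [RobinLines.dzbar]
        push_cast
        ring
    rw [h2, ← Finset.sum_sub_distrib, Finset.mul_sum, Finset.mul_sum,
      ← Finset.sum_add_distrib] at h1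
    rw [← mul_zero ((t : ℂ) ^ N), ← h1, Finset.mul_sum]
    refine Finset.sum_congr rfl fun p hp => ?_
    rw [hmon p hp]
    ring

end RobinLines

/-! ### The recursion for the amplitudes and its estimates. -/

namespace RobinLines

open Metric Set Filter Topology
open Finset.HasAntidiagonal (antidiagonal)
open scoped Nat

theorem exists_strong_recursion {X : Type*} [Inhabited X] (F : ℕ → (ℕ → X) → X)
    (hF : ∀ N f g, (∀ m < N, f m = g m) → F N f = F N g) : ∃ A : ℕ → X, ∀ N, A N = F N A := by
  classical
  refine ⟨fun N => Nat.lt_wfRel.wf.fix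
    -- Values not yet constructed are filled with `default`; by `hF` they do not influence the
    -- result.
    (fun n ih => F n fun m => if h : m < n then ih m h else default) N, fun N => ?_⟩
  refine (WellFounded.fix_eq _ _ N).trans (hF N _ _ fun m hm => ?_)
  exact dif_pos hm

/-- The amplitude attached to the angular mode `m - n` of the monomial `z^m z̄^n`. -/
def modeCoeff (A : ℕ → ℂ × ℂ) (p : ℕ × ℕ) : ℂ :=
  if p.2 ≤ p.1 then (A (p.1 - p.2)).1 else (A (p.2 - p.1)).2

/-- The coefficients of the solution of the Helmholtz equation with `4K = -k²` whose coefficients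
of `z^m` and `z̄^m` are `A m`. -/
def besselCoeff (K : ℂ) (A : ℕ → ℂ × ℂ) (p : ℕ × ℕ) : ℂ :=
  K ^ min p.1 p.2 * ((p.1 - p.2 + (p.2 - p.1))! / (p.1 ! * p.2 !)) * modeCoeff A p

/-- A step along the diagonal preserves `|m - n|`, which is what the sum of the two truncated
differences computes; only the power of `K` and the two factorials change. -/
theorem besselCoeff_succ (K : ℂ) (A : ℕ → ℂ × ℂ) (m n : ℕ) :
    (m + 1) * ((n + 1) * besselCoeff K A (m + 1, n + 1)) = K * besselCoeff K A (m, n) := by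
  have h1 : (m ! : ℂ) ≠ 0 := by exact_mod_cast m.factorial_ne_zero
  have h2 : (n ! : ℂ) ≠ 0 := by exact_mod_cast n.factorial_ne_zero
  have h3 : (m : ℂ) + 1 ≠ 0 := Nat.cast_add_one_ne_zero m
  have h4 : (n : ℂ) + 1 ≠ 0 := Nat.cast_add_one_ne_zero n
  have hmode : modeCoeff A (m + 1, n + 1) = modeCoeff A (m, n) := by
    simp [modeCoeff]
  have hmin : min (m + 1) (n + 1) = min m n + 1 := by omega
  simp only [besselCoeff, hmode, Nat.add_sub_add_right, Nat.factorial_succ, hmin, pow_succ]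
  push_cast
  field_simp

theorem besselCoeff_right_zero (K : ℂ) (A : ℕ → ℂ × ℂ) (N : ℕ) :
    besselCoeff K A (N, 0) = (A N).1 := by
  have h1 : (N ! : ℂ) ≠ 0 := by exact_mod_cast N.factorial_ne_zero
  simp [besselCoeff, modeCoeff, h1]

theorem besselCoeff_left_zero (K : ℂ) (A : ℕ → ℂ × ℂ) {N : ℕ} (hN : 0 < N) :
    besselCoeff K A (0, N) = (A N).2 := by
  have h1 : (N ! : ℂ) ≠ 0 := by exact_mod_cast N.factorial_ne_zero
  have h2 : ¬ N ≤ 0 := by omega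
  simp only [besselCoeff, modeCoeff, if_neg h2]
  simp [h1]

theorem norm_modeCoeff_le (A : ℕ → ℂ × ℂ) (p : ℕ × ℕ) :
    ‖modeCoeff A p‖ ≤ ‖A (p.1 - p.2 + (p.2 - p.1))‖ := by
  unfold modeCoeff
  split_ifs with h
  · rw [Nat.sub_eq_zero_of_le h, add_zero]
    exact norm_fst_le _
  · rw [Nat.sub_eq_zero_of_le (not_le.1 h).le, zero_add]
    exact norm_snd_le _

theorem modeCoeff_congr {A B : ℕ → ℂ × ℂ} {p : ℕ × ℕ}
    (h : A (p.1 - p.2 + (p.2 - p.1)) = B (p.1 - p.2 + (p.2 - p.1))) :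
    modeCoeff A p = modeCoeff B p := by
  unfold modeCoeff
  split_ifs with h'
  · rw [Nat.sub_eq_zero_of_le h', add_zero] at h
    rw [h]
  · rw [Nat.sub_eq_zero_of_le (not_le.1 h').le, zero_add] at h
    rw [h]

theorem factorial_ratio_le (p : ℕ × ℕ) :
    (((p.1 - p.2 + (p.2 - p.1))! : ℝ) / (p.1 ! * p.2 !)) ≤ 1 / (min p.1 p.2)! := by
  obtain ⟨m, n⟩ := p
  have hm : 0 < (m ! : ℝ) := by exact_mod_cast m.factorial_pos
  have hn : 0 < (n ! : ℝ) := by exact_mod_cast n.factorial_pos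
  rcases le_total n m with h | h
  · simp only [min_eq_right h, Nat.sub_eq_zero_of_le h, add_zero]
    rw [div_le_div_iff₀ (by positivity) hn, one_mul]
    have : ((m - n)! : ℝ) ≤ m ! := by exact_mod_cast Nat.factorial_le (Nat.sub_le m n)
    gcongr
  · simp only [min_eq_left h, Nat.sub_eq_zero_of_le h, zero_add]
    rw [div_le_div_iff₀ (by positivity) hm, one_mul, mul_comm (m ! : ℝ)]
    have : ((n - m)! : ℝ) ≤ n ! := by exact_mod_cast Nat.factorial_le (Nat.sub_le n m)
    gcongr

/-- The factor `m - n` of the angular derivative costs nothing when both exponents are nonzero,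
since `(a - b)(a - b)! ≤ (a - b + 1)! ≤ a!`. The later division by `N + 1` is thereby kept in full
to offset the small sine. -/
theorem mul_factorial_ratio_le {p : ℕ × ℕ} (h1 : p.1 ≠ 0) (h2 : p.2 ≠ 0) :
    ‖((p.1 : ℂ) - p.2)‖ * (((p.1 - p.2 + (p.2 - p.1))! : ℝ) / (p.1 ! * p.2 !))
      ≤ 1 / (min p.1 p.2)! := by
  obtain ⟨m, n⟩ := p
  simp only at h1 h2
  have hm : 0 < (m ! : ℝ) := by exact_mod_cast m.factorial_pos
  have hn : 0 < (n ! : ℝ) := by exact_mod_cast n.factorial_pos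
  have key : ∀ a b : ℕ, b ≠ 0 → b ≤ a → ((a - b : ℕ) : ℝ) * ((a - b)! : ℝ) ≤ a ! := by
    intro a b hb hab
    have h3 : (a - b) * (a - b)! ≤ a ! := by
      calc (a - b) * (a - b)! ≤ (a - b + 1) * (a - b)! := by gcongr; omega
        _ = (a - b + 1)! := (Nat.factorial_succ _).symm
        _ ≤ a ! := Nat.factorial_le (by omega)
    exact_mod_cast h3
  rcases le_total n m with h | h
  · have hd : ‖((m : ℂ) - n)‖ = ((m - n : ℕ) : ℝ) := by
      rw [← Nat.cast_sub h, Complex.norm_natCast]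
    simp only [min_eq_right h, Nat.sub_eq_zero_of_le h, add_zero, hd]
    rw [← mul_div_assoc, div_le_div_iff₀ (by positivity) hn, one_mul]
    have := key m n h2 h
    gcongr
  · have hd : ‖((m : ℂ) - n)‖ = ((n - m : ℕ) : ℝ) := by
      rw [← norm_neg, neg_sub, ← Nat.cast_sub h, Complex.norm_natCast]
    simp only [min_eq_left h, Nat.sub_eq_zero_of_le h, zero_add, hd]
    rw [← mul_div_assoc, div_le_div_iff₀ (by positivity) hm, one_mul, mul_comm (m ! : ℝ)]
    have := key n m h1 h
    gcongr

theorem norm_besselCoeff_eq (K : ℂ) (A : ℕ → ℂ × ℂ) (p : ℕ × ℕ) :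
    ‖besselCoeff K A p‖ = ‖K‖ ^ min p.1 p.2 *
      (((p.1 - p.2 + (p.2 - p.1))! : ℝ) / (p.1 ! * p.2 !)) * ‖modeCoeff A p‖ := by
  simp [besselCoeff]

/-- The degree is `m + n = |m - n| + 2 min m n`; rewriting `ε^|m-n|` in terms of the degree costs
`ε^(-2 min m n)`, hence the ratio `‖K‖ / ε²`. -/
theorem mode_bound {K : ℂ} {A : ℕ → ℂ × ℂ} {X ε : ℝ} (hε : 0 < ε) (p : ℕ × ℕ)
    (hA : ‖A (p.1 - p.2 + (p.2 - p.1))‖ ≤ X * ε ^ (p.1 - p.2 + (p.2 - p.1))) :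
    ‖K‖ ^ min p.1 p.2 * (1 / (min p.1 p.2)! : ℝ) * ‖modeCoeff A p‖
      ≤ X * ε ^ (p.1 + p.2) * ((‖K‖ / ε ^ 2) ^ min p.1 p.2 / (min p.1 p.2)!) := by
  have h1 : p.1 + p.2 = p.1 - p.2 + (p.2 - p.1) + 2 * min p.1 p.2 := by omega
  have h2 := (norm_modeCoeff_le A p).trans hA
  calc _ ≤ ‖K‖ ^ min p.1 p.2 * (1 / (min p.1 p.2)! : ℝ)
        * (X * ε ^ (p.1 - p.2 + (p.2 - p.1))) := by gcongr
    _ = _ := by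
        rw [h1, pow_add ε (p.1 - p.2 + (p.2 - p.1)), div_pow, ← pow_mul]
        generalize p.1 - p.2 + (p.2 - p.1) = d
        field_simp

theorem norm_besselCoeff_le {K : ℂ} {A : ℕ → ℂ × ℂ} {X ε : ℝ} (hε : 0 < ε) (p : ℕ × ℕ)
    (hA : ‖A (p.1 - p.2 + (p.2 - p.1))‖ ≤ X * ε ^ (p.1 - p.2 + (p.2 - p.1))) :
    ‖besselCoeff K A p‖
      ≤ X * ε ^ (p.1 + p.2) * ((‖K‖ / ε ^ 2) ^ min p.1 p.2 / (min p.1 p.2)!) := by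
  rw [norm_besselCoeff_eq]
  refine le_trans ?_ (mode_bound hε p hA)
  exact mul_le_mul_of_nonneg_right (mul_le_mul_of_nonneg_left (factorial_ratio_le p)
    (by positivity)) (norm_nonneg _)

theorem norm_mul_besselCoeff_le {K : ℂ} {A : ℕ → ℂ × ℂ} {X ε : ℝ} (hε : 0 < ε) {p : ℕ × ℕ}
    (h1 : p.1 ≠ 0) (h2 : p.2 ≠ 0)
    (hA : ‖A (p.1 - p.2 + (p.2 - p.1))‖ ≤ X * ε ^ (p.1 - p.2 + (p.2 - p.1))) :
    ‖((p.1 : ℂ) - p.2) * besselCoeff K A p‖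
      ≤ X * ε ^ (p.1 + p.2) * ((‖K‖ / ε ^ 2) ^ min p.1 p.2 / (min p.1 p.2)!) := by
  rw [norm_mul, norm_besselCoeff_eq]
  refine le_trans ?_ (mode_bound hε p hA)
  rw [← mul_assoc, mul_left_comm]
  gcongr
  exact mul_factorial_ratio_le h1 h2

/-- The essential point is uniformity in `N`: each term is dominated by one from each of two
exponential series. -/
theorem sum_antidiagonal_exp_le {Q : ℝ} (hQ : 0 ≤ Q) (N : ℕ) :
    ∑ p ∈ antidiagonal N, Q ^ min p.1 p.2 / ((min p.1 p.2)! : ℝ) ≤ 2 * Real.exp Q := by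
  have hle : ∀ p ∈ antidiagonal N, Q ^ min p.1 p.2 / ((min p.1 p.2)! : ℝ)
      ≤ Q ^ p.1 / (p.1 ! : ℝ) + Q ^ p.2 / (p.2 ! : ℝ) := by
    intro p _
    have h1 : 0 ≤ Q ^ p.1 / (p.1 ! : ℝ) := by positivity
    have h2 : 0 ≤ Q ^ p.2 / (p.2 ! : ℝ) := by positivity
    rcases le_total p.1 p.2 with h | h
    · rw [min_eq_left h]
      linarith
    · rw [min_eq_right h]
      linarith
  have hexp : ∑ p ∈ antidiagonal N, Q ^ p.1 / (p.1 ! : ℝ) ≤ Real.exp Q := by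
    rw [Finset.Nat.sum_antidiagonal_eq_sum_range_succ_mk]
    exact Real.sum_le_exp_of_nonneg hQ (N + 1)
  have hexp' : ∑ p ∈ antidiagonal N, Q ^ p.2 / (p.2 ! : ℝ) ≤ Real.exp Q := by
    rw [← Finset.Nat.sum_antidiagonal_swap]
    exact hexp
  refine (Finset.sum_le_sum hle).trans ?_
  rw [Finset.sum_add_distrib]
  linarith

/-- The value on the line `ℓ_θ`, at distance `1` from the origin, of the monomial `z^m z̄^n`. -/
def lineWeight (θ : ℝ) (p : ℕ × ℕ) : ℂ :=
  Complex.exp (Complex.I * θ) ^ p.1 * Complex.exp (-(Complex.I * θ)) ^ p.2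

theorem norm_lineWeight (θ : ℝ) (p : ℕ × ℕ) : ‖lineWeight θ p‖ = 1 := by
  simp [lineWeight, Complex.norm_exp]

/-- The contribution of the modes of order at most `N` to the term of degree `N` of the Robin
condition `γ u + ∂ₙu = 0` on `ℓ_θ`. -/
def robinRemainder (K : ℂ) (γ θ : ℝ) (N : ℕ) (A : ℕ → ℂ × ℂ) : ℂ :=
  γ * ∑ p ∈ antidiagonal N, besselCoeff K A p * lineWeight θ p
    + Complex.I * ∑ p ∈ antidiagonal (N + 1) with p.1 ≠ 0 ∧ p.2 ≠ 0,
      (p.1 - p.2) * (besselCoeff K A p * lineWeight θ p)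

theorem sub_add_sub_lt_of_mem_filter {N : ℕ} {p : ℕ × ℕ}
    (hp : p ∈ (Finset.HasAntidiagonal.antidiagonal (N + 1)).filter fun p => p.1 ≠ 0 ∧ p.2 ≠ 0) :
    p.1 + p.2 = N + 1 ∧ p.1 ≠ 0 ∧ p.2 ≠ 0 ∧ p.1 - p.2 + (p.2 - p.1) < N + 1 := by
  rw [Finset.mem_filter, Finset.HasAntidiagonal.mem_antidiagonal] at hp
  omega

theorem sub_add_sub_lt_of_mem {N : ℕ} {p : ℕ × ℕ} (hp : p ∈ antidiagonal N) :
    p.1 - p.2 + (p.2 - p.1) < N + 1 := by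
  rw [Finset.HasAntidiagonal.mem_antidiagonal] at hp
  omega

theorem robinRemainder_congr (K : ℂ) (γ θ : ℝ) {N : ℕ} {A B : ℕ → ℂ × ℂ}
    (h : ∀ m < N + 1, A m = B m) : robinRemainder K γ θ N A = robinRemainder K γ θ N B := by
  unfold robinRemainder besselCoeff
  congr 2
  · refine Finset.sum_congr rfl fun p hp => ?_
    rw [modeCoeff_congr (h _ (sub_add_sub_lt_of_mem hp))]
  · refine Finset.sum_congr rfl fun p hp => ?_
    rw [modeCoeff_congr (h _ (sub_add_sub_lt_of_mem_filter hp).2.2.2)]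

/-- The earlier modes reproduce the rate `ε^(N+1)` with a constant independent of `N`; the factor
`1/ε` on `γ` makes up for its sum having degree `N` only. -/
theorem norm_robinRemainder_le (K : ℂ) (γ θ : ℝ) {N : ℕ} {A : ℕ → ℂ × ℂ} {X ε : ℝ}
    (hε : 0 < ε) (hX : 0 ≤ X) (hA : ∀ m < N + 1, ‖A m‖ ≤ X * ε ^ m) :
    ‖robinRemainder K γ θ N A‖
      ≤ (|γ| / ε + 1) * (2 * Real.exp (‖K‖ / ε ^ 2)) * (X * ε ^ (N + 1)) := by
  have hQ : 0 ≤ ‖K‖ / ε ^ 2 := by positivity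
  have h1 : ‖∑ p ∈ antidiagonal N, besselCoeff K A p * lineWeight θ p‖
      ≤ X * ε ^ N * (2 * Real.exp (‖K‖ / ε ^ 2)) := by
    refine (norm_sum_le _ _).trans (le_trans ?_
      (mul_le_mul_of_nonneg_left (sum_antidiagonal_exp_le hQ N) (by positivity)))
    rw [Finset.mul_sum]
    refine Finset.sum_le_sum fun p hp => ?_
    rw [norm_mul, norm_lineWeight, mul_one, ← Finset.HasAntidiagonal.mem_antidiagonal.1 hp]
    exact norm_besselCoeff_le hε p (hA _ (sub_add_sub_lt_of_mem hp))
  have h2 : ‖∑ p ∈ antidiagonal (N + 1) with p.1 ≠ 0 ∧ p.2 ≠ 0,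
      ((p.1 : ℂ) - p.2) * (besselCoeff K A p * lineWeight θ p)‖
      ≤ X * ε ^ (N + 1) * (2 * Real.exp (‖K‖ / ε ^ 2)) := by
    refine (norm_sum_le _ _).trans (le_trans ?_
      (mul_le_mul_of_nonneg_left (sum_antidiagonal_exp_le hQ (N + 1)) (by positivity)))
    rw [Finset.mul_sum]
    refine le_trans (Finset.sum_le_sum fun p hp => ?_) (Finset.sum_le_sum_of_subset_of_nonneg
      (Finset.filter_subset _ _) fun p _ _ => by positivity)
    obtain ⟨h3, h4, h5, h6⟩ := sub_add_sub_lt_of_mem_filter hp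
    rw [← mul_assoc, norm_mul, norm_lineWeight, mul_one, ← h3]
    exact norm_mul_besselCoeff_le hε h4 h5 (hA _ h6)
  refine (norm_add_le _ _).trans ?_
  rw [norm_mul, norm_mul, Complex.norm_I, one_mul, Complex.norm_real, Real.norm_eq_abs]
  calc _ ≤ |γ| * (X * ε ^ N * (2 * Real.exp (‖K‖ / ε ^ 2)))
        + X * ε ^ (N + 1) * (2 * Real.exp (‖K‖ / ε ^ 2)) := by gcongr
    _ = _ := by
        rw [pow_succ]
        field_simp
        ring

theorem sum_antidiagonal_split (N : ℕ) (f : ℕ × ℕ → ℂ) :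
    ∑ p ∈ antidiagonal (N + 1), f p
      = f (N + 1, 0) + f (0, N + 1) + ∑ p ∈ antidiagonal (N + 1) with p.1 ≠ 0 ∧ p.2 ≠ 0, f p := by
  rw [← Finset.sum_filter_add_sum_filter_not (antidiagonal (N + 1))
    (fun p => p.1 ≠ 0 ∧ p.2 ≠ 0), add_comm]
  congr 1
  have h : (Finset.HasAntidiagonal.antidiagonal (N + 1)).filter (fun p => ¬ (p.1 ≠ 0 ∧ p.2 ≠ 0))
      = {(N + 1, 0), (0, N + 1)} := by
    ext ⟨m, n⟩
    simp only [Finset.mem_filter, Finset.HasAntidiagonal.mem_antidiagonal, Finset.mem_insert,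
      Finset.mem_singleton, Prod.mk.injEq]
    omega
  rw [h, Finset.sum_pair (by simp)]

/-- Among the monomials involved, only `z^(N+1)` and `z̄^(N+1)` carry angular modes `± (N+1)`; they
are the unknowns of the step. -/
theorem robin_degree_eq (K : ℂ) (γ θ : ℝ) (N : ℕ) (A : ℕ → ℂ × ℂ) :
    γ * ∑ p ∈ antidiagonal N, besselCoeff K A p * lineWeight θ p
      + Complex.I * ∑ p ∈ antidiagonal (N + 1), (p.1 - p.2) * (besselCoeff K A p * lineWeight θ p)
    = robinRemainder K γ θ N A + Complex.I * (N + 1 : ℕ) *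
      ((A (N + 1)).1 * Complex.exp ((N + 1 : ℕ) * Complex.I * θ)
        - (A (N + 1)).2 * Complex.exp (-((N + 1 : ℕ) * Complex.I * θ))) := by
  rw [sum_antidiagonal_split, robinRemainder, besselCoeff_right_zero,
    besselCoeff_left_zero K A (N := N + 1) (by omega)]
  have h1 : lineWeight θ (N + 1, 0) = Complex.exp ((N + 1 : ℕ) * Complex.I * θ) := by
    rw [lineWeight, pow_zero, mul_one, ← Complex.exp_nat_mul, mul_assoc]
  have h2 : lineWeight θ (0, N + 1) = Complex.exp (-((N + 1 : ℕ) * Complex.I * θ)) := by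
    rw [lineWeight, pow_zero, one_mul, ← Complex.exp_nat_mul, mul_neg, mul_assoc]
  rw [h1, h2]
  push_cast
  ring

/-- The amplitudes of order `N + 1` that solve the two Robin conditions in degree `N`. -/
def nextMode (K : ℂ) (γ₁ θ₁ γ₂ θ₂ : ℝ) (N : ℕ) (A : ℕ → ℂ × ℂ) : ℂ × ℂ :=
  -- Cramer's rule: `I / (N + 1)` equals `-1 / (I (N + 1))`, which moves the remainder across the
  -- equation, and the last divisor is the determinant.
  let S : ℂ := Complex.I / (N + 1 : ℕ) / (2 * Complex.I * Real.sin ((N + 1 : ℕ) * (θ₁ - θ₂)))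
  (S * (Complex.exp (-((N + 1 : ℕ) * Complex.I * θ₂)) * robinRemainder K γ₁ θ₁ N A
      - Complex.exp (-((N + 1 : ℕ) * Complex.I * θ₁)) * robinRemainder K γ₂ θ₂ N A),
    S * (Complex.exp ((N + 1 : ℕ) * Complex.I * θ₂) * robinRemainder K γ₁ θ₁ N A
      - Complex.exp ((N + 1 : ℕ) * Complex.I * θ₁) * robinRemainder K γ₂ θ₂ N A))

theorem nextMode_spec {K : ℂ} {γ₁ θ₁ γ₂ θ₂ : ℝ} {N : ℕ} {A : ℕ → ℂ × ℂ}
    (hsin : Real.sin ((N + 1 : ℕ) * (θ₁ - θ₂)) ≠ 0) (hA : A (N + 1) = nextMode K γ₁ θ₁ γ₂ θ₂ N A) :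
    robinRemainder K γ₁ θ₁ N A + Complex.I * (N + 1 : ℕ) *
      ((A (N + 1)).1 * Complex.exp ((N + 1 : ℕ) * Complex.I * θ₁)
        - (A (N + 1)).2 * Complex.exp (-((N + 1 : ℕ) * Complex.I * θ₁))) = 0 ∧
    robinRemainder K γ₂ θ₂ N A + Complex.I * (N + 1 : ℕ) *
      ((A (N + 1)).1 * Complex.exp ((N + 1 : ℕ) * Complex.I * θ₂)
        - (A (N + 1)).2 * Complex.exp (-((N + 1 : ℕ) * Complex.I * θ₂))) = 0 := by
  have hdet : 2 * Complex.I * Real.sin ((N + 1 : ℕ) * (θ₁ - θ₂))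
      = Complex.exp ((N + 1 : ℕ) * Complex.I * θ₁) * Complex.exp (-((N + 1 : ℕ) * Complex.I * θ₂))
      - Complex.exp (-((N + 1 : ℕ) * Complex.I * θ₁))
        * Complex.exp ((N + 1 : ℕ) * Complex.I * θ₂) := by
    have h := (two_lines_cramer 1 0 (N + 1) θ₁ θ₂).1
    rw [mul_one] at h
    rw [h]
    ring
  have hs : (Real.sin ((N + 1 : ℕ) * (θ₁ - θ₂)) : ℂ) ≠ 0 := by exact_mod_cast hsin
  have hdet0 : 2 * Complex.I * Real.sin ((N + 1 : ℕ) * (θ₁ - θ₂)) ≠ 0 :=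
    mul_ne_zero (mul_ne_zero two_ne_zero Complex.I_ne_zero) hs
  have hN : ((N + 1 : ℕ) : ℂ) ≠ 0 := by exact_mod_cast N.succ_ne_zero
  have hI := Complex.I_sq
  rw [hA]
  simp only [nextMode]
  generalize Complex.exp ((N + 1 : ℕ) * Complex.I * θ₁) = a at *
  generalize Complex.exp (-((N + 1 : ℕ) * Complex.I * θ₁)) = a' at *
  generalize Complex.exp ((N + 1 : ℕ) * Complex.I * θ₂) = b at *
  generalize Complex.exp (-((N + 1 : ℕ) * Complex.I * θ₂)) = b' at *
  generalize robinRemainder K γ₁ θ₁ N A = T₁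
  generalize robinRemainder K γ₂ θ₂ N A = T₂
  generalize 2 * Complex.I * (Real.sin ((N + 1 : ℕ) * (θ₁ - θ₂)) : ℂ) = d at *
  generalize ((N + 1 : ℕ) : ℂ) = n at *
  have hS : Complex.I * n * (Complex.I / n / d) * d = -1 := by
    field_simp
    exact hI
  constructor
  · linear_combination T₁ * hS - Complex.I * n * (Complex.I / n / d) * T₁ * hdet
  · linear_combination T₂ * hS - Complex.I * n * (Complex.I / n / d) * T₂ * hdet

theorem norm_nextMode_le (K : ℂ) (γ₁ θ₁ γ₂ θ₂ : ℝ) {ε : ℝ} (hε : 0 < ε) :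
    ∃ C : ℝ, 0 ≤ C ∧ ∀ (N : ℕ) (A : ℕ → ℂ × ℂ) (X : ℝ), 0 ≤ X → (∀ m < N + 1, ‖A m‖ ≤ X * ε ^ m) →
      ‖nextMode K γ₁ θ₁ γ₂ θ₂ N A‖
        ≤ C * (1 / ((N + 1 : ℕ) * |Real.sin ((N + 1 : ℕ) * (θ₁ - θ₂))|)) * (X * ε ^ (N + 1)) := by
  -- The `2` in the remainder bounds cancels against the `2` in the determinant.
  refine ⟨((|γ₁| / ε + 1) + (|γ₂| / ε + 1)) * Real.exp (‖K‖ / ε ^ 2), by positivity,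
    fun N A X hX hA => ?_⟩
  have h1 := norm_robinRemainder_le K γ₁ θ₁ hε hX hA
  have h2 := norm_robinRemainder_le K γ₂ θ₂ hε hX hA
  have hexp : ∀ t : ℝ, ‖Complex.exp ((N + 1 : ℕ) * Complex.I * t)‖ = 1 := fun t => by
    rw [Complex.norm_exp]
    simp
  have hexp' : ∀ t : ℝ, ‖Complex.exp (-((N + 1 : ℕ) * Complex.I * t))‖ = 1 := fun t => by
    rw [Complex.norm_exp]
    simp
  have hS : ‖Complex.I / (N + 1 : ℕ) / (2 * Complex.I * Real.sin ((N + 1 : ℕ) * (θ₁ - θ₂)))‖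
      = 1 / 2 * (1 / ((N + 1 : ℕ) * |Real.sin ((N + 1 : ℕ) * (θ₁ - θ₂))|)) := by
    rw [norm_div, norm_div, norm_mul, norm_mul, Complex.norm_I, Complex.norm_natCast,
      Complex.norm_real, Real.norm_eq_abs, Complex.norm_ofNat, mul_one, div_div, ← one_div_mul_one_div]
    simp only [one_div, mul_inv]
    ring
  have hfin : ∀ x y : ℂ, ‖x‖ ≤ (|γ₁| / ε + 1) * (2 * Real.exp (‖K‖ / ε ^ 2)) * (X * ε ^ (N + 1)) →
      ‖y‖ ≤ (|γ₂| / ε + 1) * (2 * Real.exp (‖K‖ / ε ^ 2)) * (X * ε ^ (N + 1)) →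
      ‖Complex.I / (N + 1 : ℕ) / (2 * Complex.I * Real.sin ((N + 1 : ℕ) * (θ₁ - θ₂))) * (x - y)‖
      ≤ ((|γ₁| / ε + 1) + (|γ₂| / ε + 1)) * Real.exp (‖K‖ / ε ^ 2)
        * (1 / ((N + 1 : ℕ) * |Real.sin ((N + 1 : ℕ) * (θ₁ - θ₂))|)) * (X * ε ^ (N + 1)) := by
    intro x y hx hy
    have hxy := (norm_sub_le x y).trans (add_le_add hx hy)
    rw [norm_mul, hS]
    refine (mul_le_mul_of_nonneg_left hxy (by positivity)).trans_eq ?_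
    ring
  refine max_le (hfin _ _ ?_ ?_) (hfin _ _ ?_ ?_)
  · rwa [norm_mul, hexp', one_mul]
  · rwa [norm_mul, hexp', one_mul]
  · rwa [norm_mul, hexp, one_mul]
  · rwa [norm_mul, hexp, one_mul]

end RobinLines

/-! ### Small denominators and the existence of a solution. -/

namespace RobinLines

open Metric Set Filter Topology

/-- With `a m ≤ X ε^m` for the earlier terms, a step is lossless when `C σ ≤ 1` and otherwise
multiplies `X` by at most `D`. Beyond `N₀` every window of `L` steps contains at most one lossy
step, so `X` grows at most like `D^(N/L)`, which is at most a constant times `2^N` once `D < 2^L`.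
This loss is absorbed by taking `ε = ρ / 2`. -/
theorem superexponential_decay {a σ : ℕ → ℝ} {S : ℝ} (ha : ∀ N, 0 ≤ a N)
    (hσ : ∀ N, σ (N + 1) ≤ S)
    (hgap : ∀ δ > 0, ∀ L : ℕ, ∃ N₀ : ℕ, ∀ N N', N₀ ≤ N → N < N' → δ < σ N → δ < σ N' → N + L ≤ N')
    (hrec : ∀ ε > 0, ∃ C : ℝ, 0 ≤ C ∧ ∀ (N : ℕ) (X : ℝ), 0 ≤ X → (∀ m < N + 1, a m ≤ X * ε ^ m) →
      a (N + 1) ≤ C * σ (N + 1) * (X * ε ^ (N + 1))) {ρ : ℝ} (hρ : 0 < ρ) :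
    ∃ M : ℝ, 0 ≤ M ∧ ∀ N, a N ≤ M * ρ ^ N := by
  obtain ⟨ε, hε, rfl⟩ : ∃ ε > 0, ρ = 2 * ε := ⟨ρ / 2, half_pos hρ, by ring⟩
  obtain ⟨C, hC, hC'⟩ := hrec ε hε
  set D := max 1 (C * S) with hD
  have hD1 : 1 ≤ D := le_max_left _ _
  obtain ⟨L, hL⟩ := pow_unbounded_of_one_lt D (one_lt_two (α := ℝ))
  have hL1 : 0 < L := by
    rcases Nat.eq_zero_or_pos L with rfl | h
    · rw [pow_zero] at hL
      linarith
    · exact h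
  -- The threshold ensures `C σ ≤ 1` at every index that does not exceed it.
  obtain ⟨N₀, hN₀⟩ := hgap (1 / (C + 1)) (by positivity) L
  have mono : ∀ (N : ℕ) (X : ℝ), 0 ≤ X → (∀ m < N, a m ≤ X * ε ^ m) →
      ∀ m < N, a m ≤ D * X * ε ^ m := fun N X hX h m hm =>
    (h m hm).trans (mul_le_mul_of_nonneg_right (le_mul_of_one_le_left hX hD1) (pow_pos hε m).le)
  have step : ∀ (N : ℕ) (X B : ℝ), 0 ≤ X → X ≤ B → C * σ (N + 1) * X ≤ B →
      (∀ m < N + 1, a m ≤ X * ε ^ m) → ∀ m < N + 1 + 1, a m ≤ B * ε ^ m := by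
    intro N X B hX hXB hB h m hm
    have hp : ∀ m, 0 ≤ ε ^ m := fun m => (pow_pos hε m).le
    rcases Nat.lt_succ_iff_lt_or_eq.1 hm with hm | rfl
    · exact (h m hm).trans (mul_le_mul_of_nonneg_right hXB (hp m))
    · refine (hC' N X hX h).trans ?_
      rw [← mul_assoc]
      exact mul_le_mul_of_nonneg_right hB (hp _)
  have hany : ∀ (N : ℕ) (X : ℝ), 0 ≤ X → (∀ m < N + 1, a m ≤ X * ε ^ m) →
      ∀ m < N + 1 + 1, a m ≤ D * X * ε ^ m := fun N X hX h =>
    step N X (D * X) hX (le_mul_of_one_le_left hX hD1) (mul_le_mul_of_nonneg_right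
      ((mul_le_mul_of_nonneg_left (hσ N) hC).trans (le_max_right _ _)) hX) h
  have hgood : ∀ (N : ℕ) (X : ℝ), 0 ≤ X → σ (N + 1) ≤ 1 / (C + 1) →
      (∀ m < N + 1, a m ≤ X * ε ^ m) → ∀ m < N + 1 + 1, a m ≤ X * ε ^ m := by
    intro N X hX hs h
    refine step N X X hX le_rfl (mul_le_of_le_one_left hX ?_) h
    refine (mul_le_mul_of_nonneg_left hs hC).trans ?_
    rw [mul_one_div, div_le_one (by positivity)]
    linarith
  -- The second component records that nothing is lost before the first bad index; it is needed so
  -- that the factor `D` is paid only once per window.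
  have window : ∀ (N : ℕ) (X : ℝ), N₀ ≤ N + 1 → 0 ≤ X → (∀ m < N + 1, a m ≤ X * ε ^ m) →
      ∀ l ≤ L, (∀ m < N + l + 1, a m ≤ D * X * ε ^ m) ∧
        ((∀ i, i < l → σ (N + i + 1) ≤ 1 / (C + 1)) → ∀ m < N + l + 1, a m ≤ X * ε ^ m) := by
    intro N X hN hX h l
    induction l with
    | zero => exact fun _ => ⟨mono _ X hX h, fun _ => h⟩
    | succ l ih =>
      intro hl
      obtain ⟨h1, h2⟩ := ih (by omega)
      by_cases hb : σ (N + l + 1) ≤ 1 / (C + 1)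
      · exact ⟨hgood _ _ (mul_nonneg (by linarith) hX) hb h1,
          fun hi => hgood _ _ hX hb (h2 fun i hil => hi i (by omega))⟩
      · refine ⟨hany _ _ hX (h2 fun i hil => ?_), fun hi => absurd (hi l (by omega)) hb⟩
        by_contra hbi
        have := hN₀ (N + i + 1) (N + l + 1) (by omega) (by omega) (not_le.1 hbi) (not_le.1 hb)
        omega
  set X₀ := ∑ m ∈ Finset.range (N₀ + 1), a m / ε ^ m with hX₀
  have hX₀0 : 0 ≤ X₀ := Finset.sum_nonneg fun m _ => div_nonneg (ha m) (pow_pos hε m).le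
  have hinit : ∀ m < N₀ + 1, a m ≤ X₀ * ε ^ m := by
    intro m hm
    rw [← div_le_iff₀ (pow_pos hε m)]
    exact Finset.single_le_sum (f := fun m => a m / ε ^ m)
      (fun m _ => div_nonneg (ha m) (pow_pos hε m).le) (Finset.mem_range.2 hm)
  have hblocks : ∀ q : ℕ, ∀ m < N₀ + q * L + 1, a m ≤ D ^ q * X₀ * ε ^ m := by
    intro q
    induction q with
    | zero => simpa using hinit
    | succ q ih =>
      have h := (window (N₀ + q * L) (D ^ q * X₀) (by omega)
        (mul_nonneg (pow_nonneg (by linarith) q) hX₀0) ih L le_rfl).1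
      rw [pow_succ', mul_assoc D, add_one_mul, ← add_assoc]
      exact h
  refine ⟨2 ^ L * X₀, by positivity, fun N => ?_⟩
  have hlt : N < N₀ + (N / L + 1) * L + 1 := by
    have := Nat.lt_div_mul_add hL1 (a := N)
    rw [add_one_mul]
    omega
  refine (hblocks (N / L + 1) N hlt).trans ?_
  have hpow : D ^ (N / L + 1) ≤ 2 ^ L * 2 ^ N := by
    calc D ^ (N / L + 1) ≤ (2 ^ L) ^ (N / L + 1) := pow_le_pow_left₀ (by linarith) hL.le _
      _ = 2 ^ L * 2 ^ (L * (N / L)) := by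
          rw [← pow_mul, ← pow_add]
          ring_nf
      _ ≤ 2 ^ L * 2 ^ N := by
          gcongr
          · norm_num
          · exact Nat.mul_div_le N L
  calc D ^ (N / L + 1) * X₀ * ε ^ N ≤ 2 ^ L * 2 ^ N * X₀ * ε ^ N := by gcongr
    _ = 2 ^ L * X₀ * (2 * ε) ^ N := by
        rw [mul_pow]
        ring

theorem exists_pos_le_of_pos {f : ℕ → ℝ} (hf : ∀ N, 0 < N → 0 < f N) (n : ℕ) :
    ∃ κ > 0, ∀ N, 0 < N → N ≤ n → κ ≤ f N := by
  induction n with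
  | zero => exact ⟨1, one_pos, fun N h1 h2 => by omega⟩
  | succ n ih =>
    obtain ⟨κ, hκ, h⟩ := ih
    refine ⟨min κ (f (n + 1)), lt_min hκ (hf _ n.succ_pos), fun N h1 h2 => ?_⟩
    rcases Nat.le_succ_iff.1 h2 with h3 | rfl
    · exact (min_le_left _ _).trans (h N h1 h3)
    · exact min_le_right _ _

/-- Jordan's inequality, after translation by the nearest multiple of `π`. -/
theorem abs_sin_ge_of_round (x : ℝ) :
    2 / Real.pi * |x - round (x / Real.pi) * Real.pi| ≤ |Real.sin x| := by
  have hπ := Real.pi_pos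
  have h1 : |x - round (x / Real.pi) * Real.pi| ≤ Real.pi / 2 := by
    have h2 : x - round (x / Real.pi) * Real.pi
        = (x / Real.pi - round (x / Real.pi)) * Real.pi := by
      field_simp
    rw [h2, abs_mul, abs_of_pos hπ]
    have := abs_sub_round (x / Real.pi)
    nlinarith
  have h3 := Real.mul_abs_le_abs_sin h1
  rwa [Real.sin_sub_int_mul_pi, abs_mul, abs_zpow, abs_neg, abs_one, one_zpow, one_mul] at h3

theorem exists_le_mul_abs_sin {Θ c : ℝ} (hΘ : ∀ q : ℚ, Θ ≠ (q : ℝ) * Real.pi) (hc : 0 < c)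
    (h : ∀ᶠ p : ℤ × ℤ in cofinite, 0 < p.1 →
      1 / (c * (p.1 : ℝ)) ≤ |(p.1 : ℝ) * Θ - (p.2 : ℝ) * Real.pi|) :
    ∃ κ > 0, ∀ N : ℕ, 0 < N → κ ≤ N * |Real.sin (N * Θ)| := by
  -- Distinct `N` give distinct pairs, so only finitely many `N` meet the exceptional set; these are
  -- handled by positivity of the sine.
  have hinj : Function.Injective fun N : ℕ => ((N : ℤ), round (N * Θ / Real.pi)) := by
    intro N N' h
    exact Int.natCast_inj.1 (Prod.ext_iff.1 h).1
  have hev := hinj.tendsto_cofinite.eventually h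
  rw [Nat.cofinite_eq_atTop] at hev
  obtain ⟨n, hn⟩ := eventually_atTop.1 hev
  obtain ⟨κ, hκ, hκ'⟩ := exists_pos_le_of_pos (f := fun N : ℕ => N * |Real.sin (N * Θ)|)
    (fun N hN => mul_pos (by exact_mod_cast hN) (abs_pos.2 (sin_natCast_mul_ne_zero hΘ hN))) n
  have hπ := Real.pi_pos
  refine ⟨min κ (2 / Real.pi / c), lt_min hκ (by positivity), fun N hN => ?_⟩
  rcases le_total N n with hle | hle
  · exact (min_le_left _ _).trans (hκ' N hN hle)
  · refine (min_le_right _ _).trans ?_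
    have h1 := hn N hle (Int.natCast_pos.2 hN)
    have h2 := abs_sin_ge_of_round (N * Θ)
    have hN' : (0 : ℝ) < N := by exact_mod_cast hN
    simp only [Int.cast_natCast] at h1
    calc 2 / Real.pi / c = N * (2 / Real.pi * (1 / (c * N))) := by field_simp
      _ ≤ N * (2 / Real.pi * |N * Θ - round (N * Θ / Real.pi) * Real.pi|) := by gcongr
      _ ≤ _ := by gcongr

theorem abs_sin_sub_le (x y : ℝ) : |Real.sin (x - y)| ≤ |Real.sin x| + |Real.sin y| := by
  rw [Real.sin_sub]
  refine (abs_sub _ _).trans ?_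
  rw [abs_mul, abs_mul]
  exact add_le_add (mul_le_of_le_one_right (abs_nonneg _) (Real.abs_cos_le_one _))
    (mul_le_of_le_one_left (abs_nonneg _) (Real.abs_cos_le_one _))

/-- If `N` and `N'` both have a large amplification, then both sines are small, hence so is `sin((N'
- N)Θ)`; for `0 < N' - N ≤ L` the latter is bounded below by a positive `κ`. -/
theorem small_denominators_gap {Θ : ℝ} (hΘ : ∀ q : ℚ, Θ ≠ (q : ℝ) * Real.pi) {δ : ℝ} (hδ : 0 < δ)
    (L : ℕ) : ∃ N₀ : ℕ, ∀ N N' : ℕ, N₀ ≤ N → N < N' →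
      δ < 1 / (N * |Real.sin (N * Θ)|) → δ < 1 / (N' * |Real.sin (N' * Θ)|) → N + L ≤ N' := by
  obtain ⟨κ, hκ, hκ'⟩ := exists_pos_le_of_pos (f := fun N : ℕ => |Real.sin (N * Θ)|)
    (fun N hN => abs_pos.2 (sin_natCast_mul_ne_zero hΘ hN)) L
  -- For `N ≥ n`, an amplification above `δ` forces the sine below `1 / (δ N) < κ / 2`.
  obtain ⟨n, hn⟩ := exists_nat_gt (2 / (δ * κ))
  have hn0 : (0 : ℝ) < n := lt_of_le_of_lt (by positivity) hn
  have hbd : ∀ N : ℕ, n ≤ N → δ < 1 / (N * |Real.sin (N * Θ)|) →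
      |Real.sin (N * Θ)| < κ / 2 := by
    intro N hN h
    have hnN : (n : ℝ) ≤ N := by exact_mod_cast hN
    have hN0 : (0 : ℝ) < N := hn0.trans_le hnN
    have hs := abs_pos.2 (sin_natCast_mul_ne_zero hΘ (by exact_mod_cast hN0 : 0 < N))
    rw [lt_div_iff₀ (by positivity)] at h
    rw [div_lt_iff₀ (by positivity)] at hn
    by_contra hcon
    push Not at hcon
    have h1 : (n : ℝ) * (δ * κ) ≤ N * (δ * (2 * |Real.sin (N * Θ)|)) := by
      gcongr
      linarith
    linarith
  refine ⟨n, fun N N' hN hlt h1 h2 => ?_⟩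
  by_contra hcon
  have h3 := hκ' (N' - N) (by omega) (by omega)
  rw [Nat.cast_sub hlt.le, sub_mul] at h3
  have h4 := abs_sin_sub_le (N' * Θ) (N * Θ)
  have h5 := hbd N hN h1
  have h6 := hbd N' (hN.trans hlt.le) h2
  linarith

theorem isEntire_besselCoeff (K : ℂ) {A : ℕ → ℂ × ℂ}
    (hA : ∀ ρ > 0, ∃ M : ℝ, 0 ≤ M ∧ ∀ N, ‖A N‖ ≤ M * ρ ^ N) : IsEntire (besselCoeff K A) := by
  intro R hR
  have hR0 : 0 < R := one_pos.trans_le hR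
  -- With this rate `ε R = 1/2`, so the series is dominated by a product of two geometric series.
  have hε : 0 < 1 / (2 * R) := by positivity
  obtain ⟨M, hM, hA'⟩ := hA _ hε
  set ε := 1 / (2 * R) with hεdef
  have hgeo : Summable fun n : ℕ => (1 / 2 : ℝ) ^ n :=
    summable_geometric_of_lt_one (by norm_num) (by norm_num)
  have hprod : Summable fun p : ℕ × ℕ => (1 / 2 : ℝ) ^ p.1 * (1 / 2 : ℝ) ^ p.2 :=
    hgeo.mul_of_nonneg hgeo (fun n => by positivity) (fun n => by positivity)
  refine Summable.of_nonneg_of_le (fun p => by positivity) (fun p => ?_)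
    (hprod.mul_left (M * Real.exp (‖K‖ / ε ^ 2)))
  have h1 := norm_besselCoeff_le (K := K) hε p (hA' _)
  have h2 : (‖K‖ / ε ^ 2) ^ min p.1 p.2 / ((min p.1 p.2).factorial : ℝ)
      ≤ Real.exp (‖K‖ / ε ^ 2) := Real.pow_div_factorial_le_exp _ (by positivity) _
  calc _ ≤ M * ε ^ (p.1 + p.2) * Real.exp (‖K‖ / ε ^ 2) * R ^ (p.1 + p.2) := by
        refine mul_le_mul_of_nonneg_right (h1.trans ?_) (by positivity)
        gcongr
    _ = M * Real.exp (‖K‖ / ε ^ 2) * (ε * R) ^ (p.1 + p.2) := by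
        rw [mul_pow]
        ring
    _ = _ := by
        have : ε * R = 1 / 2 := by
          rw [hεdef]
          field_simp
        rw [this, pow_add]

theorem exists_entire_solution {k α₁ α₂ β₁ β₂ θ₁ θ₂ c : ℝ} (hβ₁ : β₁ ≠ 0) (hβ₂ : β₂ ≠ 0)
    (hθ : ∀ q : ℚ, θ₁ - θ₂ ≠ (q : ℝ) * Real.pi) (hc : 0 < c)
    (h : ∀ᶠ p : ℤ × ℤ in cofinite, 0 < p.1 →
      1 / (c * (p.1 : ℝ)) ≤ |(p.1 : ℝ) * (θ₁ - θ₂) - (p.2 : ℝ) * Real.pi|) (Ω : Set Plane) :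
    ∃ u : Plane → ℂ, IsSolution Ω k α₁ β₁ θ₁ α₂ β₂ θ₂ u ∧ u 0 = 1 := by
  set K : ℂ := -(k ^ 2 / 4) with hK
  obtain ⟨A, hA⟩ := exists_strong_recursion (X := ℂ × ℂ)
    (fun N A => match N with
      -- The free initial amplitude, which becomes the value of the solution at `0`.
      | 0 => (1, 1)
      | N + 1 => nextMode K (α₁ / β₁) θ₁ (α₂ / β₂) θ₂ N A) (by
      rintro (_ | N) f g hfg
      · rfl
      · simp only [nextMode]
        rw [robinRemainder_congr K (α₁ / β₁) θ₁ hfg, robinRemainder_congr K (α₂ / β₂) θ₂ hfg])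
  have hA0 : A 0 = (1, 1) := hA 0
  have hAs : ∀ N, A (N + 1) = nextMode K (α₁ / β₁) θ₁ (α₂ / β₂) θ₂ N A := fun N => hA (N + 1)
  obtain ⟨κ, hκ, hκ'⟩ := exists_le_mul_abs_sin hθ hc h
  have hdecay : ∀ ρ > 0, ∃ M : ℝ, 0 ≤ M ∧ ∀ N, ‖A N‖ ≤ M * ρ ^ N := fun ρ hρ =>
    superexponential_decay (a := fun N => ‖A N‖) (S := 1 / κ)
      (σ := fun N : ℕ => 1 / (N * |Real.sin (N * (θ₁ - θ₂))|)) (fun N => norm_nonneg _)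
      (fun N => one_div_le_one_div_of_le hκ (hκ' (N + 1) N.succ_pos))
      (fun δ hδ L => small_denominators_gap hθ hδ L) (fun ε hε => by
        obtain ⟨C, hC, hC'⟩ := norm_nextMode_le K (α₁ / β₁) θ₁ (α₂ / β₂) θ₂ hε
        refine ⟨C, hC, fun N X hX hm => ?_⟩
        simp only [hAs N]
        exact hC' N A X hX hm) hρ
  have hent := isEntire_besselCoeff K hdecay
  have hscale : ∀ (α β : ℝ) (S S' : ℂ), β ≠ 0 →
      ((α / β : ℝ) : ℂ) * S + Complex.I * S' = 0 → α * S + β * Complex.I * S' = 0 := by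
    intro α β S S' hβ hS
    have hb : (β : ℂ) ≠ 0 := by exact_mod_cast hβ
    push_cast at hS
    field_simp at hS
    rw [mul_zero] at hS
    exact hS
  have hrobin : ∀ N : ℕ, _ := fun N =>
    nextMode_spec (sin_natCast_mul_ne_zero hθ N.succ_pos) (hAs N)
  refine ⟨biSeries (besselCoeff K A), ⟨hent.solvesHelmholtz (fun m n => ?_) Ω,
    hent.satisfiesRobin (fun N => ?_) Ω, hent.satisfiesRobin (fun N => ?_) Ω⟩, ?_⟩
  · rw [besselCoeff_succ, hK]
    ring
  · exact hscale _ _ _ _ hβ₁ ((robin_degree_eq K (α₁ / β₁) θ₁ N A).trans (hrobin N).1)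
  · exact hscale _ _ _ _ hβ₂ ((robin_degree_eq K (α₂ / β₂) θ₂ N A).trans (hrobin N).2)
  · rw [biSeries, tsum_eq_single (0, 0)]
    · rw [besselCoeff_right_zero, hA0]
      simp [biMonomial]
    · rintro ⟨m, n⟩ hmn
      have : m ≠ 0 ∨ n ≠ 0 := by
        by_contra hcon
        push Not at hcon
        exact hmn (Prod.ext hcon.1 hcon.2)
      rcases this with h0 | h0 <;> simp [biMonomial, h0]

/-! ### Passage between `𝕜` and `ℂ`. -/

section scalars

variable {𝕜 𝕜' : Type*} [RCLike 𝕜] [RCLike 𝕜'] {Ω : Set Plane} {k α₁ β₁ θ₁ α₂ β₂ θ₂ : ℝ}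

/-- The equation and the boundary conditions have real coefficients, so real-linear maps preserve
solutions. This carries uniqueness from `ℂ` to `𝕜` and the complex solution back to `𝕜`. -/
theorem IsSolution.clm_comp (hΩ : IsOpen Ω) (l : 𝕜 →L[ℝ] 𝕜') {U : Plane → 𝕜}
    (hU : IsSolution Ω k α₁ β₁ θ₁ α₂ β₂ θ₂ U) :
    IsSolution Ω k α₁ β₁ θ₁ α₂ β₂ θ₂ (l ∘ U) := by
  obtain ⟨⟨hC, hΔ⟩, h₁, h₂⟩ := hU
  have hCx : ∀ x ∈ Ω, ContDiffAt ℝ 2 U x := fun x hx => hC.contDiffAt (hΩ.mem_nhds hx)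
  have hR : ∀ α β θ : ℝ, SatisfiesRobin Ω α β θ U → SatisfiesRobin Ω α β θ (l ∘ U) := by
    intro α β θ h x hx
    have hd := ((hCx x hx.2).differentiableAt two_ne_zero).hasFDerivAt
    have h1 := congrArg l (h x hx)
    rw [map_add, map_smul, map_smul, map_zero] at h1
    rw [normalDeriv, (l.hasFDerivAt.comp x hd).fderiv]
    exact h1
  refine ⟨⟨l.contDiff.comp_contDiffOn hC, fun x hx => ?_⟩, hR _ _ _ h₁, hR _ _ _ h₂⟩
  have h1 := congrArg l (hΔ x hx)
  rw [map_add, map_smul, map_zero] at h1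
  rw [(hCx x hx).laplacian_CLM_comp_left]
  exact h1

theorem IsSolution.congr (hΩ : IsOpen Ω) {U V : Plane → 𝕜}
    (hU : IsSolution Ω k α₁ β₁ θ₁ α₂ β₂ θ₂ U) (h : EqOn V U Ω) :
    IsSolution Ω k α₁ β₁ θ₁ α₂ β₂ θ₂ V := by
  obtain ⟨⟨hC, hΔ⟩, h₁, h₂⟩ := hU
  have hev : ∀ x ∈ Ω, V =ᶠ[𝓝 x] U := fun x hx => h.eventuallyEq_of_mem (hΩ.mem_nhds hx)
  have hR : ∀ α β θ : ℝ, SatisfiesRobin Ω α β θ U → SatisfiesRobin Ω α β θ V := by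
    intro α β θ hr x hx
    rw [normalDeriv, (hev x hx.2).fderiv_eq, h hx.2]
    exact hr x hx
  refine ⟨⟨hC.congr h, fun x hx => ?_⟩, hR _ _ _ h₁, hR _ _ _ h₂⟩
  rw [(InnerProductSpace.laplacian_congr_nhds (hev x hx)).eq_of_nhds, h hx]
  exact hΔ x hx

theorem IsSolution.mono {Ω' : Set Plane} (hΩ : Ω' ⊆ Ω) {U : Plane → 𝕜}
    (hU : IsSolution Ω k α₁ β₁ θ₁ α₂ β₂ θ₂ U) : IsSolution Ω' k α₁ β₁ θ₁ α₂ β₂ θ₂ U :=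
  ⟨⟨hU.1.1.mono hΩ, fun x hx => hU.1.2 x (hΩ hx)⟩,
    fun x hx => hU.2.1 x ⟨hx.1, hΩ hx.2⟩, fun x hx => hU.2.2 x ⟨hx.1, hΩ hx.2⟩⟩

theorem IsSolution.eq_zero (hΩ : IsOpen Ω) (hconn : IsPreconnected Ω) (h0 : (0 : Plane) ∈ Ω)
    (hβ₁ : β₁ ≠ 0) (hβ₂ : β₂ ≠ 0) (hθ : ∀ q : ℚ, θ₁ - θ₂ ≠ (q : ℝ) * Real.pi) {U : Plane → 𝕜}
    (hU : IsSolution Ω k α₁ β₁ θ₁ α₂ β₂ θ₂ U) (hU0 : U 0 = 0) {x : Plane} (hx : x ∈ Ω) :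
    U x = 0 := by
  set l : 𝕜 →L[ℝ] ℂ := Complex.ofRealCLM.comp RCLike.reCLM
    + (RCLike.imCLM : 𝕜 →L[ℝ] ℝ).smulRight Complex.I with hl
  have hlz : ∀ z : 𝕜, l z = RCLike.re z + RCLike.im z * Complex.I := fun z => by simp [hl]
  have hlU := hU.clm_comp hΩ l
  obtain ⟨R, hR, hball⟩ := Metric.isOpen_iff.1 hΩ 0 h0
  have hloc := eventuallyEq_zero_of_robin hR (hlU.mono hball) hβ₁ hβ₂ hθ (by
    rw [Function.comp_apply, hU0, map_zero])
  have hzero := eqOn_zero_of_eventuallyEq_zero hΩ hconn hlU.1 h0 hloc hx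
  rw [Function.comp_apply, hlz] at hzero
  have hre := congrArg Complex.re hzero
  have him := congrArg Complex.im hzero
  simp only [Complex.add_re, Complex.ofReal_re, Complex.re_ofReal_mul, Complex.I_re, mul_zero,
    add_zero, Complex.zero_re, Complex.add_im, Complex.ofReal_im, Complex.im_ofReal_mul,
    Complex.I_im, mul_one, zero_add, Complex.zero_im] at hre him
  exact RCLike.ext (by simpa using hre) (by simpa using him)

end scalars

theorem zeroExt_apply {𝕜 : Type*} [RCLike 𝕜] (Ω : TopologicalSpace.Opens Plane) (u : Ω → 𝕜)
    (x : Ω) : zeroExt Ω u x = u x :=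
  Subtype.val_injective.extend_apply u 0 x

end RobinLines

end

theorem mainTheorem7 (𝕜 : Type*) [RCLike 𝕜]
    (Ω : TopologicalSpace.Opens RobinLines.Plane)
    (hΩ : IsConnected (Ω : Set RobinLines.Plane)) (h0 : (0 : RobinLines.Plane) ∈ Ω)
    (k α₁ α₂ β₁ β₂ θ₁ θ₂ : ℝ) (hβ₁ : β₁ ≠ 0) (hβ₂ : β₂ ≠ 0)
    (hθ : ∀ q : ℚ, θ₁ - θ₂ ≠ (q : ℝ) * Real.pi) :
    Module.rank 𝕜 (RobinLines.solutionSpace 𝕜 Ω k α₁ β₁ θ₁ α₂ β₂ θ₂) ≤ 1 ∧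
    ((∃ c : ℝ, Real.sqrt 5 < c ∧ ∀ᶠ p : ℤ × ℤ in Filter.cofinite, 0 < p.1 →
        1 / (c * (p.1 : ℝ)) ≤ |(p.1 : ℝ) * (θ₁ - θ₂) - (p.2 : ℝ) * Real.pi|) →
      Module.rank 𝕜 (RobinLines.solutionSpace 𝕜 Ω k α₁ β₁ θ₁ α₂ β₂ θ₂) = 1) := by
  have hle : Module.rank 𝕜 (RobinLines.solutionSpace 𝕜 Ω k α₁ β₁ θ₁ α₂ β₂ θ₂) ≤ 1 := by
    -- Evaluation at the origin, an injective linear functional by `IsSolution.eq_zero`.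
    let ev : RobinLines.solutionSpace 𝕜 Ω k α₁ β₁ θ₁ α₂ β₂ θ₂ →ₗ[𝕜] 𝕜 :=
      (LinearMap.proj (⟨0, h0⟩ : Ω)).comp (Submodule.subtype _)
    have hinj : Function.Injective ev := by
      refine (injective_iff_map_eq_zero ev).2 fun u hu => Subtype.ext (funext fun x => ?_)
      have hz : RobinLines.zeroExt Ω u.1 0 = 0 :=
        (RobinLines.zeroExt_apply Ω u.1 ⟨0, h0⟩).trans hu
      have h := RobinLines.IsSolution.eq_zero Ω.isOpen hΩ.isPreconnected h0 hβ₁ hβ₂ hθ u.2 hz x.2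
      rwa [RobinLines.zeroExt_apply] at h
    exact (LinearMap.rank_le_of_injective ev hinj).trans_eq (Module.rank_self 𝕜)
  refine ⟨hle, fun ⟨c, hc, hbad⟩ => le_antisymm hle ?_⟩
  obtain ⟨v, hv, hv0⟩ := RobinLines.exists_entire_solution (k := k) (α₁ := α₁) (α₂ := α₂) hβ₁ hβ₂
    hθ ((Real.sqrt_nonneg 5).trans_lt hc) hbad (Ω : Set RobinLines.Plane)
  -- The real part of the complex solution, viewed in `𝕜`, still has value `1` at `0` and so is
  -- nonzero.
  let l : ℂ →L[ℝ] 𝕜 := RCLike.ofRealCLM.comp Complex.reCLM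
  have hmem : (fun x : Ω => l (v x)) ∈ RobinLines.solutionSpace 𝕜 Ω k α₁ β₁ θ₁ α₂ β₂ θ₂ :=
    (hv.clm_comp Ω.isOpen l).congr Ω.isOpen fun x hx => RobinLines.zeroExt_apply Ω _ ⟨x, hx⟩
  rw [Cardinal.one_le_iff_ne_zero, ← pos_iff_ne_zero, rank_pos_iff_exists_ne_zero]
  refine ⟨⟨_, hmem⟩, fun h => ?_⟩
  have h1 := congrFun (congrArg Subtype.val h) ⟨0, h0⟩
  simp [l, hv0] at h1
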